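/- Let $(A_n,B_n)_{n\ge 1}$ be i.i.d. random pairs with values in $[0,\infty)\times\mathbb R$, let $(A,B)$ denote a generic pair, and put $$Y_n=B_1+A_1B_2+\cdots+(A_1\cdots A_{n-1})B_n,\qquad \tau_u=\inf\{n\ge 1: Y_n>u\}.$$ Let $\lambda(s)=\mathbb E[A^s]$, $\Lambda(s)=\log\lambda(s)$ (with value $+\infty$ where $\lambda(s)=\infty$), and $\Lambda^*(x)=\sup_{s\in\mathbb R}\{sx-\Lambda(s)\}$. Let $\rho>0$ and $\alpha>1$ be such that $\rho=\Lambda'(\alpha)$, and put $\overline\alpha=\Lambda^*(\rho)/\rho$. Suppose that - $\mathbb E\log A<0$ (the value $-\infty$ is allowed), and $\mathbb E A^{\alpha+\varepsilon}<\infty$, $\mathbb E|B|^{\alpha+\varepsilon}<\infty$ for some $\varepsilon>0$; - $\Lambda(\alpha)<\Lambda(1)$; - $B>0$ almost surely; - there are $0<b_1<b_2$, a nonzero finite Borel measure $\nu$ on $\mathbb R$ and a continuous function $g_A:(0,\infty)\to(0,\infty)$ such that, with $\mu$ the law of $(A,B)$, $\mathbf 1_{(b_1,b_2)}(b)\,\mu(da,db)\ge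 \mathbf 1_{(0,\infty)}(a)\,g_A(a)\,da\,\nu(db)$ as measures on $\mathbb R^2$. Then there are $\delta>0$ and $C>0$ such that for all sufficiently large $u$ $$\mathbb P\big[\tau_u=\lfloor \log u/\rho\rfloor\big]\ \ge\ \frac{C}{\sqrt{\log u}}\,u^{-\overline\alpha}\,u^{\delta}.$$ In particular, with $\Theta(u)=\log u/\rho-\lfloor\log u/\rho\rfloor$, there is no constant $c$ for which $$\mathbb P\big[\tau_u=\lfloor \log u/\rho\rfloor\big]\sim \frac{c\,\lambda(\alpha)^{-\Theta(u)}}{\sqrt{\log u}}\,u^{-\overline\alpha}\qquad\text{as } u\to\infty .$$ -/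

import Mathlib

open MeasureTheory ProbabilityTheory Filter Set
open scoped ENNReal Topology

namespace Perpetuity

noncomputable section

variable {Ω : Type*} [MeasurableSpace Ω]

/-- The moment generating function `λ(s) = E[X ^ s] ∈ [0, ∞]`, `s ∈ ℝ`, of a nonnegative random
variable `X`. -/
def moment (P : Measure Ω) (X : Ω → ℝ) (s : ℝ) : ℝ≥0∞ :=
  ∫⁻ ω, ENNReal.ofReal (X ω) ^ s ∂P

/-- `Λ(s) = log λ(s)`, with value `+∞` where `λ(s) = ∞`. -/
def logMoment (P : Measure Ω) (X : Ω → ℝ) (s : ℝ) : EReal :=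
  ENNReal.log (moment P X s)

/-- The convex conjugate `Λ*(x) = sup_{s ∈ ℝ} (s x - Λ(s))`. -/
def conjugate (P : Measure Ω) (X : Ω → ℝ) (x : ℝ) : EReal :=
  ⨆ s : ℝ, ((s * x : ℝ) : EReal) - logMoment P X s

/-- The exponent `Λ*(ρ) / ρ`. -/
def alphaBar (P : Measure Ω) (X : Ω → ℝ) (ρ : ℝ) : ℝ :=
  (conjugate P X ρ).toReal / ρ

/-- `E log X < 0` for a nonnegative `X`, the values `log 0 = -∞` and `E log X = -∞` being allowed:
the expectation of the positive part of `log X` is smaller than that of its negative part. -/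
def NegativeDrift (P : Measure Ω) (X : Ω → ℝ) : Prop :=
  ∫⁻ ω, (ENNReal.log (ENNReal.ofReal (X ω))).toENNReal ∂P <
    ∫⁻ ω, (-ENNReal.log (ENNReal.ofReal (X ω))).toENNReal ∂P

/-- The perpetuity `Y_n = B_1 + A_1 B_2 + ⋯ + (A_1 ⋯ A_{n-1}) B_n`, where `A i`, `B i` stand for
`A_{i+1}`, `B_{i+1}`. -/
def perpetuity (A B : ℕ → Ω → ℝ) (n : ℕ) (ω : Ω) : ℝ :=
  ∑ i ∈ Finset.range n, (∏ j ∈ Finset.range i, A j ω) * B i ω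

/-- The first passage time `τ_u = inf {n ≥ 1 : Y_n > u}`, equal to `∞` if there is no such `n`. -/
def passageTime (A B : ℕ → Ω → ℝ) (u : ℝ) (ω : Ω) : ℕ∞ :=
  ⨅ (n : ℕ) (_ : 1 ≤ n ∧ u < perpetuity A B n ω), (n : ℕ∞)

/-- The probability `P[τ_u = ⌊log u / ρ⌋]`. -/
def passageProb (P : Measure Ω) (A B : ℕ → Ω → ℝ) (ρ u : ℝ) : ℝ :=
  P.real {ω | passageTime A B u ω = (⌊Real.log u / ρ⌋₊ : ℕ∞)}

end

end Perpetuity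

/-! Write `Λ(s) = log E[A ^ s]` and `t = log u`. Since `ρ = Λ'(α)`, the exponent is `ᾱ = α - Λ(α) /
ρ`, the cost of climbing to `u` at constant slope `ρ` over `t / ρ` steps. When `Λ(α) < Λ(1)` there
is a cheaper strategy. Climb at a slope `r = Λ'(s) > ρ` with `s` slightly larger than `α`, so that
`Y` is already near `u` at time `t / r`, and then wait. The increments of `Y` shrink during the
waiting, but the probability that a level is crossed in a given step is governed by the expected
increment, which costs only `Λ(1)` per step. The resulting exponent `-s + Λ(s) / r + Λ(1) (1 / ρ - 1
/ r)` exceeds `-ᾱ` by strict convexity of `Λ` at `α`; this is `exists_better_slope`.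

Three ingredients make this rigorous. By Fubini, the integral over levels `v` of the probability of
crossing `v` in one step is an expected increment
(`lintegral_increment_le_setLIntegral_crossingProb`). That increment is bounded below by an
exponential change of measure with tilt `s` while climbing and tilt `1` while waiting; Markov and
Chernoff bounds keep `Y` in a window around `u` (`le_lintegral_increment`). Finally the density
component of `(A, B)` turns the average over levels into a bound at the single level `u`: `j` extra
initial steps spread the level over a window of ratio exponential in `j`, at a cost also exponential
in `j` (`exists_setLIntegral_le_crossingProb_add`). With `j` a small multiple of `t`, the window
absorbs the fluctuations of the climb and the cost is a small power of `u`
(`eventually_le_crossingProb`).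

Because `A ≥ 0` and `B > 0`, the perpetuity is nondecreasing, so crossing `u` at step `n` means `τ_u
= n`. -/

namespace Perpetuity

noncomputable section

/-! ### I.i.d. sequences and the decomposition at the first step. -/

/-- The law of an i.i.d. sequence of pairs with common law `m`. -/
abbrev iidLaw (m : Measure (ℝ × ℝ)) : Measure (ℕ → ℝ × ℝ) := Measure.infinitePi fun _ => m

/-- The perpetuity as a function of the sequence of pairs. -/
def seqPerpetuity (n : ℕ) (z : ℕ → ℝ × ℝ) : ℝ :=
  perpetuity (fun i z => (z i).1) (fun i z => (z i).2) n z

/-- Prepend an element to a sequence. -/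
def prepend {E : Type*} (x : E × (ℕ → E)) : ℕ → E := fun n => Nat.casesOn n x.1 x.2

@[simp] lemma prepend_zero {E : Type*} (x : E × (ℕ → E)) : prepend x 0 = x.1 := rfl

@[simp] lemma prepend_succ {E : Type*} (x : E × (ℕ → E)) (n : ℕ) :
    prepend x (n + 1) = x.2 n := rfl

lemma measurable_prepend {E : Type*} [MeasurableSpace E] :
    Measurable (prepend : E × (ℕ → E) → ℕ → E) := by
  refine measurable_pi_iff.2 fun n => ?_
  cases n with
  | zero => exact measurable_fst
  | succ n => exact (measurable_pi_apply n).comp measurable_snd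

/-- Allows conditioning on the first pair: the remaining pairs again have law `iidLaw m`. It
suffices to compare the masses of finite-dimensional boxes. -/
lemma map_prepend_prod_iidLaw (m : Measure (ℝ × ℝ)) [IsProbabilityMeasure m] :
    (m.prod (iidLaw m)).map prepend = iidLaw m := by
  refine Measure.eq_infinitePi _ fun s t ht => ?_
  rw [Measure.map_apply measurable_prepend
    (MeasurableSet.pi s.countable_toSet fun i _ => ht i)]
  have hpre : prepend ⁻¹' ((s : Set ℕ).pi t) =
      (if 0 ∈ s then t 0 else univ) ×ˢ
        ((s.preimage Nat.succ Nat.succ_injective.injOn : Finset ℕ) : Set ℕ).pi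
          (fun i => t (i + 1)) := by
    ext x
    simp only [mem_preimage, Set.mem_pi, Finset.mem_coe, mem_prod, Finset.mem_preimage]
    constructor
    · intro h
      refine ⟨?_, fun i hi => h (i + 1) hi⟩
      split_ifs with h0
      · exact h 0 h0
      · trivial
    · rintro ⟨h0, h1⟩ i hi
      cases i with
      | zero => simpa [hi] using h0
      | succ i => exact h1 i hi
  rw [hpre, Measure.prod_prod, Measure.infinitePi_pi _ fun i _ => ht (i + 1)]
  have himg : ∏ i ∈ s.preimage Nat.succ Nat.succ_injective.injOn, m (t (i + 1)) =
      ∏ i ∈ s.erase 0, m (t i) := by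
    refine Finset.prod_bij (fun i _ => i + 1) ?_ ?_ ?_ ?_
    · intro i hi; simpa using hi
    · intro i _ j _ h; simpa using h
    · intro j hj
      obtain ⟨hj0, hj⟩ := Finset.mem_erase.1 hj
      obtain ⟨i, rfl⟩ := Nat.exists_eq_succ_of_ne_zero hj0
      exact ⟨i, by simpa using hj, rfl⟩
    · intro i _; rfl
  rw [himg]
  split_ifs with h0
  · exact Finset.mul_prod_erase s (fun i => m (t i)) h0
  · rw [measure_univ, one_mul, Finset.erase_eq_of_notMem h0]

lemma lintegral_iidLaw_prod (m : Measure (ℝ × ℝ)) [IsProbabilityMeasure m] (s : Finset ℕ)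
    (h : ℕ → ℝ × ℝ → ℝ≥0∞) (hh : ∀ i, Measurable (h i)) :
    ∫⁻ z, ∏ i ∈ s, h i (z i) ∂iidLaw m = ∏ i ∈ s, ∫⁻ p, h i p ∂m := by
  have hi : iIndepFun (fun i (z : ℕ → ℝ × ℝ) => h i (z i)) (iidLaw m) :=
    iIndepFun_infinitePi hh
  have := lintegral_prod_eq_prod_lintegral_of_indepFun s _ hi
    (fun i => (hh i).comp (measurable_pi_apply i))
  rw [this]
  refine Finset.prod_congr rfl fun i _ => ?_
  exact (measurePreserving_eval_infinitePi (fun _ : ℕ => m) i).lintegral_comp (hh i)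

lemma seqPerpetuity_succ (n : ℕ) (z : ℕ → ℝ × ℝ) :
    seqPerpetuity (n + 1) z = seqPerpetuity n z + (∏ j ∈ Finset.range n, (z j).1) * (z n).2 :=
  Finset.sum_range_succ _ _

lemma measurable_seqPerpetuity (n : ℕ) : Measurable (seqPerpetuity n) := by
  unfold seqPerpetuity perpetuity
  fun_prop

lemma seqPerpetuity_prepend (n : ℕ) (p : ℝ × ℝ) (z : ℕ → ℝ × ℝ) :
    seqPerpetuity (n + 1) (prepend (p, z)) = p.2 + p.1 * seqPerpetuity n z := by
  simp only [seqPerpetuity, perpetuity, Finset.sum_range_succ', Finset.prod_range_succ',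
    prepend_zero, prepend_succ, Finset.mul_sum, Finset.prod_range_zero, one_mul]
  rw [add_comm]
  congr 1
  exact Finset.sum_congr rfl fun i _ => by ring

/-! ### Crossing probabilities and steering of the level by the density component. -/

/-- The probability that the perpetuity with common law `m` exceeds `u` at time `k + 1` but not at
time `k`. -/
def crossingProb (m : Measure (ℝ × ℝ)) (k : ℕ) (u : ℝ) : ℝ≥0∞ :=
  iidLaw m {z | seqPerpetuity k z ≤ u ∧ u < seqPerpetuity (k + 1) z}

lemma measurableSet_crossing (k : ℕ) :
    MeasurableSet {x : ℝ × (ℕ → ℝ × ℝ) |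
      seqPerpetuity k x.2 ≤ x.1 ∧ x.1 < seqPerpetuity (k + 1) x.2} :=
  (measurableSet_le ((measurable_seqPerpetuity k).comp measurable_snd) measurable_fst).inter
    (measurableSet_lt measurable_fst ((measurable_seqPerpetuity (k + 1)).comp measurable_snd))

lemma measurable_crossingProb (m : Measure (ℝ × ℝ)) [IsProbabilityMeasure m] (k : ℕ) :
    Measurable (crossingProb m k) :=
  measurable_measure_prodMk_left (measurableSet_crossing k)

/-- If the first pair is `(a, b)` with `a > 0`, crossing `u` means that the shifted perpetuity
crosses `(u - b) / a` one step earlier. Only an inequality is claimed because pairs with `a ≤ 0` are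
dropped. -/
lemma setLIntegral_crossingProb_le_succ (m : Measure (ℝ × ℝ)) [IsProbabilityMeasure m] (k : ℕ)
    (u : ℝ) :
    ∫⁻ p in {p : ℝ × ℝ | 0 < p.1}, crossingProb m k ((u - p.2) / p.1) ∂m ≤
      crossingProb m (k + 1) u := by
  have hms : MeasurableSet {z : ℕ → ℝ × ℝ |
      seqPerpetuity (k + 1) z ≤ u ∧ u < seqPerpetuity (k + 1 + 1) z} :=
    (measurableSet_crossing (k + 1)).preimage (measurable_const.prodMk measurable_id)
  rw [crossingProb, ← map_prepend_prod_iidLaw m, Measure.map_apply measurable_prepend hms,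
    Measure.prod_apply (measurable_prepend hms)]
  refine (lintegral_mono_ae ?_).trans (setLIntegral_le_lintegral {p : ℝ × ℝ | 0 < p.1} _)
  refine (ae_restrict_iff' (measurableSet_lt measurable_const measurable_fst)).2
    (ae_of_all _ fun p hp => ?_)
  refine measure_mono fun z hz => ?_
  simp only [mem_ofPred_eq] at hz hp
  simp only [mem_preimage, mem_ofPred_eq, seqPerpetuity_prepend]
  rw [le_div_iff₀ hp, div_lt_iff₀ hp] at hz
  constructor <;> nlinarith [hz.1, hz.2]

/-- The law `m` has, on `ℝ × (b₁, b₂)`, a component of the form `g(a) da ν(db)` with `g` positive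
and continuous on `(0, ∞)`. -/
structure HasDensityComponent (m : Measure (ℝ × ℝ)) (b₁ b₂ : ℝ) (ν : Measure ℝ) (g : ℝ → ℝ) :
    Prop where
  pos : 0 < b₁
  ne_zero : ν ≠ 0
  cont : ContinuousOn g (Ioi 0)
  pos_density : ∀ a, 0 < a → 0 < g a
  le : ((volume.restrict (Ioi (0 : ℝ))).withDensity (fun a => ENNReal.ofReal (g a))).prod ν ≤
    m.restrict (univ ×ˢ Ioo b₁ b₂)

/-- On the compact interval `[x, y]` the continuous positive `g` has a positive minimum, which
serves as `c`. -/
lemma HasDensityComponent.exists_lintegral_le {m : Measure (ℝ × ℝ)} {b₁ b₂ : ℝ} {ν : Measure ℝ}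
    [IsFiniteMeasure ν] {g : ℝ → ℝ} (h : HasDensityComponent m b₁ b₂ ν g) {x y : ℝ} (hx : 0 < x)
    (hxy : x ≤ y) :
    ∃ c : ℝ, 0 < c ∧ ∀ f : ℝ × ℝ → ℝ≥0∞, Measurable f →
      ENNReal.ofReal c * ∫⁻ b, (∫⁻ a in Icc x y, f (a, b)) ∂ν ≤
        ∫⁻ p in univ ×ˢ Ioo b₁ b₂, f p ∂m := by
  have hsub : Icc x y ⊆ Ioi (0 : ℝ) := fun a ha => hx.trans_le ha.1
  obtain ⟨a₀, ha₀, hmin⟩ := isCompact_Icc.exists_isMinOn (nonempty_Icc.2 hxy) (h.cont.mono hsub)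
  refine ⟨g a₀, h.pos_density _ (hsub ha₀), fun f hf => ?_⟩
  refine le_trans ?_ (lintegral_mono' h.le le_rfl)
  have hle : ENNReal.ofReal (g a₀) • volume.restrict (Icc x y) ≤
      (volume.restrict (Ioi (0 : ℝ))).withDensity (fun a => ENNReal.ofReal (g a)) := by
    refine Measure.le_iff.2 fun s hs => ?_
    rw [withDensity_apply _ hs, Measure.restrict_restrict hs, Measure.smul_apply,
      Measure.restrict_apply hs, smul_eq_mul]
    calc ENNReal.ofReal (g a₀) * volume (s ∩ Icc x y)
        = ∫⁻ _ in s ∩ Icc x y, ENNReal.ofReal (g a₀) := by simp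
      _ ≤ ∫⁻ a in s ∩ Icc x y, ENNReal.ofReal (g a) :=
          setLIntegral_mono' (hs.inter measurableSet_Icc) fun a ha =>
            ENNReal.ofReal_le_ofReal (hmin ha.2)
      _ ≤ _ := lintegral_mono_set (inter_subset_inter_right _ hsub)
  have : SFinite ((volume.restrict (Ioi (0 : ℝ))).withDensity (fun a => ENNReal.ofReal (g a))) :=
    inferInstance
  refine le_trans (le_of_eq ?_) (lintegral_mono' (Measure.prod_mono hle le_rfl) le_rfl)
  rw [lintegral_prod_symm _ hf.aemeasurable, ← lintegral_const_mul']
  · simp [lintegral_smul_measure]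
  · exact ENNReal.ofReal_ne_top

/-- Substitution `v = w / a`: as `a` runs over `[1/8, 4]`, `v` covers `[w / 4, 8 w]`, which contains
`[u / 4, 4 u]`, and the Jacobian `w / a ^ 2` is at most `64 u`. -/
lemma setLIntegral_le_setLIntegral_div (F : ℝ → ℝ≥0∞) {w u : ℝ} (hw : u / 2 ≤ w) (hwu : w ≤ u)
    (hu : 0 < u) :
    ∫⁻ v in Icc (u / 4) (4 * u), F v ≤
      ENNReal.ofReal (64 * u) * ∫⁻ a in Icc (1 / 8 : ℝ) 4, F (w / a) := by
  have hw0 : 0 < w := by linarith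
  have himg : Icc (u / 4) (4 * u) ⊆ (fun a => w / a) '' Icc (1 / 8 : ℝ) 4 := by
    intro v hv
    have hv0 : 0 < v := by linarith [hv.1]
    refine ⟨w / v, ⟨?_, ?_⟩, by field_simp⟩
    · rw [le_div_iff₀ hv0]; linarith [hv.2]
    · rw [div_le_iff₀ hv0]; linarith [hv.1]
  refine (lintegral_mono_set himg).trans ?_
  have hpos : ∀ a ∈ Icc (1 / 8 : ℝ) 4, 0 < a := fun a ha => by linarith [ha.1]
  rw [lintegral_image_eq_lintegral_abs_deriv_mul (f' := fun a => -w / a ^ 2) measurableSet_Icc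
    (fun a ha => ?_) (fun a ha a' ha' h => ?_) F]
  · rw [← lintegral_const_mul' _ _ ENNReal.ofReal_ne_top]
    refine setLIntegral_mono' measurableSet_Icc fun a ha => ?_
    gcongr
    have ha0 := hpos a ha
    rw [neg_div, abs_neg, abs_of_nonneg (by positivity), div_le_iff₀ (by positivity)]
    nlinarith [ha.1, mul_le_mul ha.1 ha.1 (by norm_num) ha0.le]
  · have ha0 := hpos a ha
    have := ((hasDerivAt_inv ha0.ne').const_mul w).hasDerivWithinAt (s := Icc (1 / 8 : ℝ) 4)
    simpa [div_eq_mul_inv] using this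
  · have ha0 := hpos a ha
    have ha0' := hpos a' ha'
    have h : w / a = w / a' := h
    rw [div_eq_div_iff ha0.ne' ha0'.ne'] at h
    exact (mul_left_cancel₀ hw0.ne' h).symm

/-- One random factor `A` with a density smooths the level: after the first step, the level `(u - b)
/ a` still to be crossed has a density of order at least `1 / u` on `[u / 4, 4 u]`. -/
lemma HasDensityComponent.exists_setLIntegral_le_crossingProb_succ {m : Measure (ℝ × ℝ)}
    [IsProbabilityMeasure m] {b₁ b₂ : ℝ} {ν : Measure ℝ}
    [IsFiniteMeasure ν] {g : ℝ → ℝ} (h : HasDensityComponent m b₁ b₂ ν g) :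
    ∃ c : ℝ, 0 < c ∧ ∀ k u, 0 < u → 2 * b₂ ≤ u →
      ENNReal.ofReal (c / u) * ∫⁻ v in Icc (u / 4) (4 * u), crossingProb m k v ≤
        crossingProb m (k + 1) u := by
  obtain ⟨c, hc, hle⟩ := h.exists_lintegral_le (x := 1 / 8) (y := 4) (by norm_num) (by norm_num)
  -- The restricted law gives no mass to second coordinates outside `(b₁, b₂)`, so the component
  -- below it forces the same on `ν`.
  have hν : ν (Ioo b₁ b₂)ᶜ = 0 := by
    have := hle (indicator (univ ×ˢ (Ioo b₁ b₂)ᶜ) 1)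
      (measurable_one.indicator (MeasurableSet.univ.prod measurableSet_Ioo.compl))
    have hz : ∫⁻ p in univ ×ˢ Ioo b₁ b₂, indicator (univ ×ˢ (Ioo b₁ b₂)ᶜ) (1 : ℝ × ℝ → ℝ≥0∞) p ∂m
        = 0 := by
      rw [setLIntegral_congr_fun (g := fun _ => 0)
        (MeasurableSet.univ.prod measurableSet_Ioo) (fun p hp => ?_)]
      · simp
      · rw [indicator_of_notMem]
        intro hp'
        exact hp'.2 hp.2
    rw [hz, nonpos_iff_eq_zero, mul_eq_zero] at this
    have h1 : ∫⁻ b, (∫⁻ a in Icc (1 / 8 : ℝ) 4,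
        indicator (univ ×ˢ (Ioo b₁ b₂)ᶜ) (1 : ℝ × ℝ → ℝ≥0∞) (a, b)) ∂ν = 0 :=
      this.resolve_left (by simpa using hc)
    have h2 : ∀ b, (∫⁻ a in Icc (1 / 8 : ℝ) 4,
        indicator (univ ×ˢ (Ioo b₁ b₂)ᶜ) (1 : ℝ × ℝ → ℝ≥0∞) (a, b)) =
        indicator (Ioo b₁ b₂)ᶜ (fun _ => ENNReal.ofReal (4 - 1 / 8)) b := by
      intro b
      by_cases hb : b ∈ (Ioo b₁ b₂)ᶜ
      · have : ∀ a : ℝ, indicator (univ ×ˢ (Ioo b₁ b₂)ᶜ) (1 : ℝ × ℝ → ℝ≥0∞) (a, b) = 1 :=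
          fun a => by rw [indicator_of_mem (by exact ⟨trivial, hb⟩)]; rfl
        simp only [this, indicator_of_mem hb]
        simp
      · have : ∀ a : ℝ, indicator (univ ×ˢ (Ioo b₁ b₂)ᶜ) (1 : ℝ × ℝ → ℝ≥0∞) (a, b) = 0 :=
          fun a => by rw [indicator_of_notMem (fun hp => hb hp.2)]
        simp only [this, indicator_of_notMem hb]
        simp
    simp only [h2] at h1
    rw [lintegral_indicator_const measurableSet_Ioo.compl, mul_eq_zero] at h1
    exact h1.resolve_left (by norm_num)
  have hν0 : 0 < ν.real univ := by
    rw [measureReal_def]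
    exact ENNReal.toReal_pos (by simpa using h.ne_zero) (measure_ne_top _ _)
  refine ⟨c * ν.real univ / 64, by positivity, fun k u hu hub => ?_⟩
  have hF : Measurable fun p : ℝ × ℝ =>
      indicator {p : ℝ × ℝ | 0 < p.1} (fun p => crossingProb m k ((u - p.2) / p.1)) p := by
    refine Measurable.indicator ?_ (measurableSet_lt measurable_const measurable_fst)
    exact (measurable_crossingProb m k).comp (by fun_prop)
  refine le_trans ?_ (setLIntegral_crossingProb_le_succ m k u)
  rw [← lintegral_indicator (measurableSet_lt measurable_const measurable_fst)]
  refine le_trans ?_ (setLIntegral_le_lintegral (univ ×ˢ Ioo b₁ b₂) _)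
  refine le_trans ?_ (hle _ hF)
  set J := ∫⁻ v in Icc (u / 4) (4 * u), crossingProb m k v with hJ
  have key : ∫⁻ _, ENNReal.ofReal (1 / (64 * u)) * J ∂ν ≤
      ∫⁻ b, (∫⁻ a in Icc (1 / 8 : ℝ) 4, indicator {p : ℝ × ℝ | 0 < p.1}
        (fun p => crossingProb m k ((u - p.2) / p.1)) (a, b)) ∂ν := by
    refine lintegral_mono_ae ?_
    have : ∀ᵐ b ∂ν, b ∈ Ioo b₁ b₂ := hν
    filter_upwards [this] with b hb
    have h1 := setLIntegral_le_setLIntegral_div (crossingProb m k) (w := u - b) (u := u)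
      (by linarith [hb.2]) (by linarith [hb.1, h.pos]) hu
    have h2 : ∫⁻ a in Icc (1 / 8 : ℝ) 4, indicator {p : ℝ × ℝ | 0 < p.1}
        (fun p => crossingProb m k ((u - p.2) / p.1)) (a, b) =
        ∫⁻ a in Icc (1 / 8 : ℝ) 4, crossingProb m k ((u - b) / a) := by
      refine setLIntegral_congr_fun measurableSet_Icc fun a ha => ?_
      have ha0 : 0 < a := by linarith [ha.1]
      exact indicator_of_mem (s := {p : ℝ × ℝ | 0 < p.1}) (a := (a, b)) ha0 _
    rw [h2]
    calc ENNReal.ofReal (1 / (64 * u)) * J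
        ≤ ENNReal.ofReal (1 / (64 * u)) * (ENNReal.ofReal (64 * u) *
          ∫⁻ a in Icc (1 / 8 : ℝ) 4, crossingProb m k ((u - b) / a)) := by gcongr
      _ = _ := by
        rw [← mul_assoc, ← ENNReal.ofReal_mul (by positivity), one_div_mul_cancel (by positivity),
          ENNReal.ofReal_one, one_mul]
  calc ENNReal.ofReal (c * ν.real univ / 64 / u) * J
      = ENNReal.ofReal c * (ENNReal.ofReal (1 / (64 * u)) * J * ν univ) := by
        rw [show c * ν.real univ / 64 / u = c * (1 / (64 * u) * ν.real univ) by field_simp,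
          ENNReal.ofReal_mul hc.le, ENNReal.ofReal_mul (by positivity), ofReal_measureReal]
        ring
    _ ≤ _ := by
        gcongr
        rwa [lintegral_const] at key

/-- Iterating the one-step bound: in `j` steps the level can be steered by a factor
`2 ^ (j + 1)` at the price of an exponential factor in `j`. -/
lemma HasDensityComponent.exists_setLIntegral_le_crossingProb_add {m : Measure (ℝ × ℝ)}
    [IsProbabilityMeasure m] {b₁ b₂ : ℝ} {ν : Measure ℝ}
    [IsFiniteMeasure ν] {g : ℝ → ℝ} (h : HasDensityComponent m b₁ b₂ ν g) :
    ∃ c : ℝ, 0 < c ∧ ∀ j k u, 0 < u → 2 * b₂ * 4 ^ j ≤ u →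
      ENNReal.ofReal (c ^ (j + 1) / u) *
          ∫⁻ v in Icc (u / 2 ^ (j + 2)) (2 ^ (j + 2) * u), crossingProb m k v ≤
        crossingProb m (k + (j + 1)) u := by
  obtain ⟨c, hc, hstep⟩ := h.exists_setLIntegral_le_crossingProb_succ
  -- Averaging the induction hypothesis over an interval of levels loses a factor 2 per step, hence
  -- `c / 2`. Levels as low as `u / 4` are used, hence the `4 ^ j` in the lower bound on `u`.
  refine ⟨c / 2, by positivity, fun j => ?_⟩
  induction j with
  | zero =>
    intro k u hu hub
    have := hstep k u hu (by simpa using hub)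
    norm_num at this ⊢
    refine le_trans ?_ this
    gcongr
    linarith
  | succ j ih =>
    intro k u hu hub
    have hub1 : 2 * b₂ ≤ u := by
      rcases le_or_gt 0 b₂ with h | h
      · refine le_trans ?_ hub
        exact le_mul_of_one_le_right (by linarith) (one_le_pow₀ (by norm_num))
      · linarith
    have hub2 : 2 * b₂ * 4 ^ j ≤ u / 4 := by rw [pow_succ] at hub; linarith
    refine le_trans ?_ (hstep (k + (j + 1)) u hu hub1)
    set p : ℝ := 2 ^ j with hp
    have hp1 : 1 ≤ p := one_le_pow₀ (by norm_num)
    have e2 : (2 : ℝ) ^ (j + 2) = 4 * p := by rw [hp]; ring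
    have e3 : (2 : ℝ) ^ (j + 1 + 2) = 8 * p := by rw [hp]; ring
    rw [e3]
    simp only [e2] at ih
    set I1 := ∫⁻ v in Icc (u / p) (8 * p * u), crossingProb m k v with hI1
    set I2 := ∫⁻ v in Icc (u / (8 * p)) (p * u), crossingProb m k v with hI2
    set C : ℝ := (c / 2) ^ (j + 1) with hC
    have hC0 : 0 < C := by positivity
    -- Levels `w` in `[2u, 4u]` reach the upper end of the enlarged window, levels in `[u/4, u/2]`
    -- (`low2`) its lower end. Both subintervals lie in `[u/4, 4u]`, and the two windows reached
    -- cover the enlarged one.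
    have low1 : ENNReal.ofReal (C / 2) * I1 ≤
        ∫⁻ w in Icc (2 * u) (4 * u), crossingProb m (k + (j + 1)) w := by
      calc ENNReal.ofReal (C / 2) * I1
          = ENNReal.ofReal (C / (4 * u)) * I1 * volume (Icc (2 * u) (4 * u)) := by
            rw [Real.volume_Icc, mul_right_comm, ← ENNReal.ofReal_mul (by positivity)]
            congr 2; field_simp; ring
        _ = ∫⁻ w in Icc (2 * u) (4 * u), ENNReal.ofReal (C / (4 * u)) * I1 := by
            rw [setLIntegral_const]
        _ ≤ _ := by
            refine setLIntegral_mono' measurableSet_Icc fun w hw => ?_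
            have hw0 : 0 < w := by linarith [hw.1]
            refine le_trans ?_ (ih k w hw0 (by linarith [hw.1]))
            refine mul_le_mul' (ENNReal.ofReal_le_ofReal ?_)
              (lintegral_mono_set (Icc_subset_Icc ?_ ?_))
            · exact div_le_div_of_nonneg_left hC0.le hw0 hw.2
            · rw [div_le_div_iff₀ (by positivity) (by positivity)]
              nlinarith [hw.2]
            · nlinarith [hw.1]
    have low2 : ENNReal.ofReal (C / 2) * I2 ≤
        ∫⁻ w in Icc (u / 4) (u / 2), crossingProb m (k + (j + 1)) w := by
      calc ENNReal.ofReal (C / 2) * I2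
          = ENNReal.ofReal (C / (u / 2)) * I2 * volume (Icc (u / 4) (u / 2)) := by
            rw [Real.volume_Icc, mul_right_comm, ← ENNReal.ofReal_mul (by positivity)]
            congr 2; field_simp; ring
        _ = ∫⁻ w in Icc (u / 4) (u / 2), ENNReal.ofReal (C / (u / 2)) * I2 := by
            rw [setLIntegral_const]
        _ ≤ _ := by
            refine setLIntegral_mono' measurableSet_Icc fun w hw => ?_
            have hw0 : 0 < w := by linarith [hw.1]
            refine le_trans ?_ (ih k w hw0 (by linarith [hw.1]))
            refine mul_le_mul' (ENNReal.ofReal_le_ofReal ?_)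
              (lintegral_mono_set (Icc_subset_Icc ?_ ?_))
            · exact div_le_div_of_nonneg_left hC0.le hw0 hw.2
            · rw [div_le_div_iff₀ (by positivity) (by positivity)]
              nlinarith [hw.2]
            · nlinarith [hw.1]
    have hcov : Icc (u / (8 * p)) (8 * p * u) ⊆
        Icc (u / p) (8 * p * u) ∪ Icc (u / (8 * p)) (p * u) := by
      intro v hv
      rcases le_total v (p * u) with h | h
      · exact Or.inr ⟨hv.1, h⟩
      · refine Or.inl ⟨le_trans ?_ h, hv.2⟩
        rw [div_le_iff₀ (by positivity)]
        nlinarith [mul_le_mul hp1 hp1 (by norm_num) (by linarith)]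
    calc ENNReal.ofReal ((c / 2) ^ (j + 1 + 1) / u) *
          ∫⁻ v in Icc (u / (8 * p)) (8 * p * u), crossingProb m k v
        ≤ ENNReal.ofReal ((c / 2) ^ (j + 1 + 1) / u) * (I1 + I2) := by
          gcongr
          exact (lintegral_mono_set hcov).trans (lintegral_union_le _ _ _)
      _ = ENNReal.ofReal (c / u) * (ENNReal.ofReal (C / 2) * I1 + ENNReal.ofReal (C / 2) * I2) := by
          rw [← mul_add, ← mul_assoc, ← ENNReal.ofReal_mul (by positivity)]
          congr 2
          rw [pow_succ, ← hC]; ring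
      _ ≤ ENNReal.ofReal (c / u) *
          ((∫⁻ w in Icc (2 * u) (4 * u), crossingProb m (k + (j + 1)) w) +
            ∫⁻ w in Icc (u / 4) (u / 2), crossingProb m (k + (j + 1)) w) := by gcongr
      _ = ENNReal.ofReal (c / u) *
          ∫⁻ w in Icc (2 * u) (4 * u) ∪ Icc (u / 4) (u / 2), crossingProb m (k + (j + 1)) w := by
          rw [lintegral_union measurableSet_Icc]
          refine Set.disjoint_left.2 fun x hx hx' => ?_
          linarith [hx.1, hx'.2]
      _ ≤ _ := by
          gcongr
          refine union_subset (Icc_subset_Icc_left (by linarith)) (Icc_subset_Icc_right (by linarith))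

/-! ### Expected increments and fractional moments of the perpetuity. -/

/-- The integrated crossing probability is the expected overshoot interval length. -/
lemma lintegral_increment_le_setLIntegral_crossingProb (m : Measure (ℝ × ℝ))
    [IsProbabilityMeasure m] (k : ℕ) (x y : ℝ) :
    ∫⁻ z in {z | x ≤ seqPerpetuity k z ∧ seqPerpetuity (k + 1) z ≤ y},
        ENNReal.ofReal (seqPerpetuity (k + 1) z - seqPerpetuity k z) ∂iidLaw m ≤
      ∫⁻ v in Icc x y, crossingProb m k v := by
  have hS := measurableSet_crossing k
  have h1 : ∫⁻ v in Icc x y, crossingProb m k v =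
      ∫⁻ z, (volume.restrict (Icc x y))
        {v | seqPerpetuity k z ≤ v ∧ v < seqPerpetuity (k + 1) z} ∂iidLaw m := by
    -- Tonelli: for a fixed sequence, the levels crossed at step `k + 1` form the interval `[Y_k,
    -- Y_{k+1})`.
    have a1 := Measure.prod_apply (μ := volume.restrict (Icc x y)) (ν := iidLaw m) hS
    have a2 := Measure.prod_apply_symm (μ := volume.restrict (Icc x y)) (ν := iidLaw m) hS
    exact a1.symm.trans a2
  rw [h1]
  refine le_trans ?_ (setLIntegral_le_lintegral
    {z | x ≤ seqPerpetuity k z ∧ seqPerpetuity (k + 1) z ≤ y} _)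
  refine setLIntegral_mono' ((measurableSet_le measurable_const (measurable_seqPerpetuity k)).inter
    (measurableSet_le (measurable_seqPerpetuity (k + 1)) measurable_const)) fun z hz => ?_
  have : {v | seqPerpetuity k z ≤ v ∧ v < seqPerpetuity (k + 1) z} =
    Ico (seqPerpetuity k z) (seqPerpetuity (k + 1) z) := rfl
  rw [this, Measure.restrict_apply measurableSet_Ico, inter_eq_left.2, Real.volume_Ico]
  exact fun v hv => ⟨hz.1.trans hv.1, hv.2.le.trans hz.2⟩

lemma rpow_finsetSum_le_sum_rpow {ι : Type*} (s : Finset ι) (f : ι → ℝ≥0∞) {θ : ℝ} (h0 : 0 < θ)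
    (h1 : θ ≤ 1) : (∑ i ∈ s, f i) ^ θ ≤ ∑ i ∈ s, f i ^ θ := by
  classical
  induction s using Finset.induction_on with
  | empty => simp [h0]
  | insert a s ha ih =>
    rw [Finset.sum_insert ha, Finset.sum_insert ha]
    exact (ENNReal.rpow_add_le_add_rpow _ _ h0.le h1).trans (by gcongr)

/-- Subadditivity of `x ↦ x ^ θ` for `θ ≤ 1` replaces the sum by products of functions of single
coordinates, which factorize under independence. -/
lemma ofReal_seqPerpetuity_rpow_le {z : ℕ → ℝ × ℝ} (hz : ∀ i, 0 ≤ (z i).1) (N : ℕ) {θ : ℝ}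
    (h0 : 0 < θ) (h1 : θ ≤ 1) :
    ENNReal.ofReal (seqPerpetuity N z) ^ θ ≤ ∑ i ∈ Finset.range N,
      (∏ j ∈ Finset.range i, ENNReal.ofReal (z j).1 ^ θ) * ENNReal.ofReal (z i).2 ^ θ := by
  have hle : ENNReal.ofReal (seqPerpetuity N z) ≤ ∑ i ∈ Finset.range N,
      (∏ j ∈ Finset.range i, ENNReal.ofReal (z j).1) * ENNReal.ofReal (z i).2 := by
    induction N with
    | zero => simp [seqPerpetuity, perpetuity]
    | succ N ih =>
      rw [seqPerpetuity_succ, Finset.sum_range_succ]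
      refine ENNReal.ofReal_add_le.trans (add_le_add ih ?_)
      rw [ENNReal.ofReal_mul (Finset.prod_nonneg fun i _ => hz i),
        ENNReal.ofReal_prod_of_nonneg fun i _ => hz i]
  refine (ENNReal.rpow_le_rpow hle h0.le).trans
    ((rpow_finsetSum_le_sum_rpow _ _ h0 h1).trans (le_of_eq ?_))
  refine Finset.sum_congr rfl fun i _ => ?_
  rw [ENNReal.mul_rpow_of_nonneg _ _ h0.le, ENNReal.prod_rpow_of_nonneg h0.le]

/-- A bound for the `θ`-th moment of the perpetuity under a product of weights. -/
lemma lintegral_weight_mul_seqPerpetuity_rpow_le (m : Measure (ℝ × ℝ)) [IsProbabilityMeasure m]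
    (hm : ∀ᵐ z ∂iidLaw m, ∀ i, 0 ≤ (z i).1) (w : ℕ → ℝ × ℝ → ℝ≥0∞) (hw : ∀ i, Measurable (w i))
    (N : ℕ) {θ : ℝ} (h0 : 0 < θ) (h1 : θ ≤ 1) (r : ℕ → ℝ≥0∞) (C : ℝ≥0∞) (hr : ∀ i, 1 ≤ r i)
    (ha : ∀ i, ∫⁻ p, w i p * ENNReal.ofReal p.1 ^ θ ∂m ≤ r i * ∫⁻ p, w i p ∂m)
    (hb : ∀ i, ∫⁻ p, w i p * ENNReal.ofReal p.2 ^ θ ∂m ≤ C * ∫⁻ p, w i p ∂m) :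
    ∫⁻ z, (∏ i ∈ Finset.range N, w i (z i)) * ENNReal.ofReal (seqPerpetuity N z) ^ θ ∂iidLaw m ≤
      N * C * (∏ i ∈ Finset.range N, r i) * ∏ i ∈ Finset.range N, ∫⁻ p, w i p ∂m := by
  -- `h i j` is the factor at coordinate `j` of the weighted `i`-th summand. Coordinates after `i`
  -- contribute the bare weight; there `1 ≤ r j` completes the product of the `r j` to the full
  -- range.
  set h : ℕ → ℕ → ℝ × ℝ → ℝ≥0∞ := fun i j p => w j p *
    if j < i then ENNReal.ofReal p.1 ^ θ else if j = i then ENNReal.ofReal p.2 ^ θ else 1 with hh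
  have hmeas : ∀ i j, Measurable (h i j) := by
    intro i j
    simp only [hh]
    split_ifs
    · exact (hw j).mul (measurable_fst.ennreal_ofReal.pow_const _)
    · exact (hw j).mul (measurable_snd.ennreal_ofReal.pow_const _)
    · exact (hw j).mul measurable_const
  have hprod : ∀ z : ℕ → ℝ × ℝ, ∀ i ∈ Finset.range N, (∏ j ∈ Finset.range N, w j (z j)) *
      ((∏ j ∈ Finset.range i, ENNReal.ofReal (z j).1 ^ θ) * ENNReal.ofReal (z i).2 ^ θ) =
      ∏ j ∈ Finset.range N, h i j (z j) := by
    intro z i hi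
    rw [Finset.mem_range] at hi
    simp only [hh, Finset.prod_mul_distrib]
    congr 1
    obtain ⟨d, rfl⟩ := Nat.exists_eq_add_of_lt hi
    rw [show i + d + 1 = i + 1 + d by ring, Finset.prod_range_add, Finset.prod_range_succ]
    have e1 : ∏ x ∈ Finset.range d, (if i + 1 + x < i then ENNReal.ofReal (z (i + 1 + x)).1 ^ θ
        else if i + 1 + x = i then ENNReal.ofReal (z (i + 1 + x)).2 ^ θ else 1) = 1 :=
      Finset.prod_eq_one fun x _ => by rw [if_neg (by omega), if_neg (by omega)]
    rw [e1, mul_one]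
    simp only [lt_irrefl, if_false, if_true]
    congr 1
    exact Finset.prod_congr rfl fun j hj => by rw [if_pos (Finset.mem_range.1 hj)]
  have hint : ∀ i ∈ Finset.range N, ∫⁻ z, ∏ j ∈ Finset.range N, h i j (z j) ∂iidLaw m ≤
      C * (∏ i ∈ Finset.range N, r i) * ∏ i ∈ Finset.range N, ∫⁻ p, w i p ∂m := by
    intro i hi
    rw [lintegral_iidLaw_prod m _ _ (hmeas i)]
    calc ∏ j ∈ Finset.range N, ∫⁻ p, h i j p ∂m
        ≤ ∏ j ∈ Finset.range N, ((if j = i then C else 1) * r j) * ∫⁻ p, w j p ∂m := by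
          refine Finset.prod_le_prod' fun j _ => ?_
          simp only [hh]
          by_cases hj : j = i
          · subst hj
            simp only [lt_irrefl, if_false, if_true]
            refine (hb j).trans ?_
            gcongr
            exact le_mul_of_one_le_right' (hr j)
          · simp only [hj, if_false, one_mul]
            split_ifs
            · exact ha j
            · simpa using mul_le_mul_left (hr j) (∫⁻ p, w j p ∂m)
      _ = _ := by
          rw [Finset.prod_mul_distrib, Finset.prod_mul_distrib, Finset.prod_ite_eq', if_pos hi]
  calc ∫⁻ z, (∏ i ∈ Finset.range N, w i (z i)) * ENNReal.ofReal (seqPerpetuity N z) ^ θ ∂iidLaw m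
      ≤ ∫⁻ z, ∑ i ∈ Finset.range N, ∏ j ∈ Finset.range N, h i j (z j) ∂iidLaw m := by
        refine lintegral_mono_ae ?_
        filter_upwards [hm] with z hz
        refine (mul_le_mul_right (ofReal_seqPerpetuity_rpow_le hz N h0 h1) _).trans (le_of_eq ?_)
        rw [Finset.mul_sum]
        exact Finset.sum_congr rfl (hprod z)
    _ = ∑ i ∈ Finset.range N, ∫⁻ z, ∏ j ∈ Finset.range N, h i j (z j) ∂iidLaw m := by
        rw [lintegral_finsetSum]
        exact fun i _ => Finset.measurable_fun_prod _ fun j _ =>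
          (hmeas i j).comp (measurable_pi_apply j)
    _ ≤ _ := (Finset.sum_le_sum hint).trans (le_of_eq (by simp [mul_assoc]))

/-! ### The change of measure: climbing with tilt `s`, then waiting with tilt `1`. -/

/-- The moment `E[A ^ s]` in terms of the law of `(A, B)`. -/
def lawMoment (m : Measure (ℝ × ℝ)) (s : ℝ) : ℝ≥0∞ := ∫⁻ p, ENNReal.ofReal p.1 ^ s ∂m

/-- The weights: `A ^ s` during the first `L` steps, then `A` on `{B > b₁}`, then `A` for `K`
steps and finally `B`. -/
def crossingWeight (s b₁ : ℝ) (L K i : ℕ) (p : ℝ × ℝ) : ℝ≥0∞ :=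
  if i < L then ENNReal.ofReal p.1 ^ s
  else if i = L then {p : ℝ × ℝ | b₁ < p.2}.indicator (fun p => ENNReal.ofReal p.1) p
  else if i < L + 1 + K then ENNReal.ofReal p.1
  else ENNReal.ofReal p.2

lemma measurable_crossingWeight (s b₁ : ℝ) (L K i : ℕ) :
    Measurable (crossingWeight s b₁ L K i) := by
  unfold crossingWeight
  split_ifs
  · exact measurable_fst.ennreal_ofReal.pow_const _
  · exact measurable_fst.ennreal_ofReal.indicator (measurableSet_lt measurable_const measurable_snd)
  · exact measurable_fst.ennreal_ofReal
  · exact measurable_snd.ennreal_ofReal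

lemma prod_crossingWeight {M : Type*} [CommMonoid M] (s b₁ : ℝ) (L K : ℕ)
    (φ : ℕ → (ℝ × ℝ → ℝ≥0∞) → M) :
    ∏ i ∈ Finset.range (L + 1 + K + 1), φ i (crossingWeight s b₁ L K i) =
      (∏ i ∈ Finset.range L, φ i fun p => ENNReal.ofReal p.1 ^ s) *
        (φ L ({p : ℝ × ℝ | b₁ < p.2}.indicator fun p => ENNReal.ofReal p.1) *
          (∏ i ∈ Finset.range K, φ (L + 1 + i) fun p => ENNReal.ofReal p.1) *
          φ (L + 1 + K) fun p => ENNReal.ofReal p.2) := by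
  rw [Finset.prod_range_succ, Finset.prod_range_add, Finset.prod_range_succ]
  have e1 : ∀ i ∈ Finset.range L, φ i (crossingWeight s b₁ L K i) =
      φ i fun p => ENNReal.ofReal p.1 ^ s := by
    intro i hi
    congr 1; funext p
    simp [crossingWeight, Finset.mem_range.1 hi]
  have e2 : φ L (crossingWeight s b₁ L K L) =
      φ L ({p : ℝ × ℝ | b₁ < p.2}.indicator fun p => ENNReal.ofReal p.1) := by
    congr 1; funext p
    simp [crossingWeight]
  have e3 : ∀ i ∈ Finset.range K, φ (L + 1 + i) (crossingWeight s b₁ L K (L + 1 + i)) =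
      φ (L + 1 + i) fun p => ENNReal.ofReal p.1 := by
    intro i hi
    have := Finset.mem_range.1 hi
    congr 1; funext p
    rw [crossingWeight, if_neg (by omega), if_neg (by omega), if_pos (by omega)]
  have e4 : φ (L + 1 + K) (crossingWeight s b₁ L K (L + 1 + K)) =
      φ (L + 1 + K) fun p => ENNReal.ofReal p.2 := by
    congr 1; funext p
    rw [crossingWeight, if_neg (by omega), if_neg (by omega), if_neg (by omega)]
  rw [Finset.prod_congr rfl e1, e2, Finset.prod_congr rfl e3, e4]
  simp only [mul_assoc]

lemma monotone_seqPerpetuity {z : ℕ → ℝ × ℝ} (hz : ∀ i, 0 ≤ (z i).1 ∧ 0 < (z i).2) :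
    Monotone fun n => seqPerpetuity n z := by
  refine monotone_nat_of_le_succ fun n => ?_
  rw [seqPerpetuity_succ]
  have := mul_nonneg (Finset.prod_nonneg fun j (_ : j ∈ Finset.range n) => (hz j).1) (hz n).2.le
  linarith

/-- On the good event the weight is dominated by the increment of the perpetuity. -/
lemma prod_crossingWeight_le_increment {z : ℕ → ℝ × ℝ} (hz : ∀ i, 0 ≤ (z i).1 ∧ 0 < (z i).2)
    {s b₁ x y : ℝ} (hs : 1 ≤ s) (hb₁ : 0 < b₁) (hy : 0 < y) (L K : ℕ)
    (hx : x ≤ b₁ * ∏ j ∈ Finset.range L, (z j).1)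
    (hYy : seqPerpetuity (L + 1 + K + 1) z ≤ y) :
    ENNReal.ofReal ((y / b₁) ^ (1 - s)) *
        ∏ i ∈ Finset.range (L + 1 + K + 1), crossingWeight s b₁ L K i (z i) ≤
      {z | x ≤ seqPerpetuity (L + 1 + K) z ∧ seqPerpetuity (L + 1 + K + 1) z ≤ y}.indicator
        (fun z => ENNReal.ofReal (seqPerpetuity (L + 1 + K + 1) z - seqPerpetuity (L + 1 + K) z))
        z := by
  rw [prod_crossingWeight s b₁ L K (fun i w => w (z i))]
  by_cases hb : b₁ < (z L).2
  swap
  · have : {p : ℝ × ℝ | b₁ < p.2}.indicator (fun p => ENNReal.ofReal p.1) (z L) = 0 :=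
      indicator_of_notMem (s := {p : ℝ × ℝ | b₁ < p.2}) hb _
    simp [this]
  have hind : {p : ℝ × ℝ | b₁ < p.2}.indicator (fun p => ENNReal.ofReal p.1) (z L) =
    ENNReal.ofReal (z L).1 := indicator_of_mem (s := {p : ℝ × ℝ | b₁ < p.2}) hb _
  have hmono := monotone_seqPerpetuity hz
  set π := ∏ j ∈ Finset.range L, (z j).1 with hπ
  have hπ0 : 0 ≤ π := Finset.prod_nonneg fun j _ => (hz j).1
  have hYL : b₁ * π ≤ seqPerpetuity (L + 1) z := by
    have h1 : 0 ≤ seqPerpetuity L z := by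
      have := hmono (Nat.zero_le L)
      simpa [seqPerpetuity, perpetuity] using this
    rw [seqPerpetuity_succ, ← hπ]
    nlinarith
  have hY1 : seqPerpetuity (L + 1) z ≤ seqPerpetuity (L + 1 + K) z := hmono (by omega)
  have hY2 : seqPerpetuity (L + 1 + K) z ≤ seqPerpetuity (L + 1 + K + 1) z := hmono (by omega)
  rw [hind, indicator_of_mem (s := {z | x ≤ seqPerpetuity (L + 1 + K) z ∧
    seqPerpetuity (L + 1 + K + 1) z ≤ y}) ⟨by linarith, hYy⟩, seqPerpetuity_succ (L + 1 + K),
    add_sub_cancel_left, Finset.prod_range_add, Finset.prod_range_succ, ← hπ]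
  have hρ0 : 0 ≤ ∏ i ∈ Finset.range K, (z (L + 1 + i)).1 := Finset.prod_nonneg fun j _ => (hz _).1
  rw [ENNReal.ofReal_mul (mul_nonneg (mul_nonneg hπ0 (hz L).1) hρ0),
    ENNReal.ofReal_mul (mul_nonneg hπ0 (hz L).1), ENNReal.ofReal_mul hπ0,
    ENNReal.ofReal_prod_of_nonneg (s := Finset.range K) (fun i _ => (hz _).1)]
  have hpow : ∏ i ∈ Finset.range L, ENNReal.ofReal (z i).1 ^ s = ENNReal.ofReal (π ^ s) := by
    rw [ENNReal.prod_rpow_of_nonneg (by linarith), ← ENNReal.ofReal_prod_of_nonneg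
      (fun i _ => (hz _).1), ENNReal.ofReal_rpow_of_nonneg hπ0 (by linarith)]
  rw [hpow, ← mul_assoc, ← ENNReal.ofReal_mul (by positivity)]
  -- The increment contains `π` to the first power, the weight `π ^ s`. The event `Y ≤ y` forces `π
  -- ≤ y / b₁`, through the step `L` with `B > b₁`, and `1 - s ≤ 0` turns this into the conversion
  -- factor.
  have hmain : (y / b₁) ^ (1 - s) * π ^ s ≤ π := by
    have hq : π ≤ y / b₁ := by
      rw [le_div_iff₀ hb₁]; linarith
    have hq0 : 0 < y / b₁ := by positivity
    rcases hπ0.eq_or_lt with h | h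
    · rw [← h, Real.zero_rpow (by linarith)]; simp
    calc (y / b₁) ^ (1 - s) * π ^ s ≤ π ^ (1 - s) * π ^ s := by
          gcongr ?_ * _
          exact Real.rpow_le_rpow_of_nonpos h hq (by linarith)
      _ = π := by rw [← Real.rpow_add h]; simp
  calc _ ≤ ENNReal.ofReal π * (ENNReal.ofReal (z L).1 *
        (∏ i ∈ Finset.range K, ENNReal.ofReal (z (L + 1 + i)).1) *
        ENNReal.ofReal (z (L + 1 + K)).2) := by gcongr
    _ = _ := by simp only [mul_assoc]

/-- Lower bound for the expected increment of the perpetuity over the step `L + 1 + K` on the event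
that the perpetuity stays in `[x, y]`. -/
lemma le_lintegral_increment (m : Measure (ℝ × ℝ)) [IsProbabilityMeasure m]
    (hm : ∀ᵐ z ∂iidLaw m, ∀ i, 0 ≤ (z i).1 ∧ 0 < (z i).2)
    {s θ b₁ x y : ℝ} (hs : 1 ≤ s) (hθ0 : 0 < θ) (hθ1 : θ ≤ 1) (hb₁ : 0 < b₁)
    (hy : 0 < y) (L K : ℕ) (r R C qL qB : ℝ≥0∞)
    (hqL : qL = ∫⁻ p in {p : ℝ × ℝ | b₁ < p.2}, ENNReal.ofReal p.1 ∂m)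
    (hqB : qB = ∫⁻ p, ENNReal.ofReal p.2 ∂m)
    (hqL_top : qL ≠ ∞) (hqB_top : qB ≠ ∞)
    (hs_top : lawMoment m s ≠ ∞) (h1_top : lawMoment m 1 ≠ ∞)
    (hr1 : 1 ≤ r) (hR1 : 1 ≤ R)
    (ha_s : lawMoment m (s + θ) ≤ r * lawMoment m s)
    (ha_1 : lawMoment m (1 + θ) ≤ lawMoment m 1)
    (ha_L : lawMoment m (1 + θ) ≤ R * qL)
    (ha_B : ∫⁻ p, ENNReal.ofReal p.2 * ENNReal.ofReal p.1 ^ θ ∂m ≤ R * qB)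
    (hb_s : ∫⁻ p, ENNReal.ofReal p.1 ^ s * ENNReal.ofReal p.2 ^ θ ∂m ≤ C * lawMoment m s)
    (hb_1 : ∫⁻ p, ENNReal.ofReal p.1 * ENNReal.ofReal p.2 ^ θ ∂m ≤ C * lawMoment m 1)
    (hb_L : ∫⁻ p, ENNReal.ofReal p.1 * ENNReal.ofReal p.2 ^ θ ∂m ≤ C * qL)
    (hb_B : ∫⁻ p, ENNReal.ofReal p.2 * ENNReal.ofReal p.2 ^ θ ∂m ≤ C * qB)
    (hlow : ENNReal.ofReal (x / b₁) ^ θ * lawMoment m (s - θ) ^ L ≤ 4⁻¹ * lawMoment m s ^ L)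
    (hup : ((L + 1 + K + 1 : ℕ) : ℝ≥0∞) * C * (r ^ L * R * R) ≤ ENNReal.ofReal y ^ θ * 4⁻¹) :
    ENNReal.ofReal ((y / b₁) ^ (1 - s)) *
        (2⁻¹ * (lawMoment m s ^ L * (qL * lawMoment m 1 ^ K * qB))) ≤
      ∫⁻ z in {z | x ≤ seqPerpetuity (L + 1 + K) z ∧ seqPerpetuity (L + 1 + K + 1) z ≤ y},
        ENNReal.ofReal (seqPerpetuity (L + 1 + K + 1) z - seqPerpetuity (L + 1 + K) z)
          ∂iidLaw m := by
  set N := L + 1 + K + 1 with hN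
  set W : (ℕ → ℝ × ℝ) → ℝ≥0∞ := fun z => ∏ i ∈ Finset.range N, crossingWeight s b₁ L K i (z i)
    with hW
  set E := lawMoment m s ^ L * (qL * lawMoment m 1 ^ K * qB) with hE
  have hqL' : qL = ∫⁻ p, {p : ℝ × ℝ | b₁ < p.2}.indicator (fun p => ENNReal.ofReal p.1) p ∂m := by
    rw [lintegral_indicator (measurableSet_lt measurable_const measurable_snd), hqL]
  have h1eq : ∫⁻ p : ℝ × ℝ, ENNReal.ofReal p.1 ∂m = lawMoment m 1 := by simp [lawMoment]
  have hprodE : ∀ s', ∏ i ∈ Finset.range N, ∫⁻ p, crossingWeight s' b₁ L K i p ∂m =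
      lawMoment m s' ^ L * (qL * lawMoment m 1 ^ K * qB) := by
    intro s'
    rw [hN, prod_crossingWeight s' b₁ L K (fun i w => ∫⁻ p, w p ∂m)]
    simp only [Finset.prod_const, Finset.card_range, h1eq, ← hqL', ← hqB]
    rfl
  have hWE : ∫⁻ z, W z ∂iidLaw m = E := by
    rw [lintegral_iidLaw_prod m _ _ (measurable_crossingWeight s b₁ L K), hprodE]
  have hE_top : E ≠ ∞ := by
    refine ENNReal.mul_ne_top (ENNReal.pow_ne_top hs_top) (ENNReal.mul_ne_top
      (ENNReal.mul_ne_top hqL_top (ENNReal.pow_ne_top h1_top)) hqB_top)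
  have hWm : Measurable W := Finset.measurable_fun_prod _ fun i _ =>
    (measurable_crossingWeight s b₁ L K i).comp (measurable_pi_apply i)
  have hYm := measurable_seqPerpetuity N
  have hPm : Measurable fun z : ℕ → ℝ × ℝ => b₁ * ∏ j ∈ Finset.range L, (z j).1 := by fun_prop
  set G : Set (ℕ → ℝ × ℝ) :=
    {z | x ≤ b₁ * ∏ j ∈ Finset.range L, (z j).1 ∧ seqPerpetuity N z ≤ y} with hG
  set U : Set (ℕ → ℝ × ℝ) := {z | y < seqPerpetuity N z} with hU
  set D : Set (ℕ → ℝ × ℝ) := {z | b₁ * ∏ j ∈ Finset.range L, (z j).1 < x} with hD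
  have hGm : MeasurableSet G :=
    (measurableSet_le measurable_const hPm).inter (measurableSet_le hYm measurable_const)
  have hUm : MeasurableSet U := measurableSet_lt measurable_const hYm
  have hDm : MeasurableSet D := measurableSet_lt hPm measurable_const
  -- the perpetuity is too large
  have hUle : ∫⁻ z in U, W z ∂iidLaw m ≤ 4⁻¹ * E := by
    -- Growth of the `θ`-th moment per step under the tilted law. The factor is 1 while waiting, by
    -- `ha_1`, so the bound on `Y` grows exponentially only with the length `L` of the climb;
    -- Markov's inequality then controls `U`.
    set rr : ℕ → ℝ≥0∞ := fun i => if i < L then r else if i = L then R else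
      if i < L + 1 + K then 1 else R with hrr
    have hmom := lintegral_weight_mul_seqPerpetuity_rpow_le m
      (hm.mono fun z hz i => (hz i).1) (crossingWeight s b₁ L K)
      (measurable_crossingWeight s b₁ L K) N hθ0 hθ1 rr C
      (fun i => by simp only [hrr]; split_ifs <;> first | assumption | exact le_rfl) ?_ ?_
    · have hrprod : ∏ i ∈ Finset.range N, rr i = r ^ L * R * R := by
        rw [hN, Finset.prod_range_succ, Finset.prod_range_add, Finset.prod_range_succ]
        have e1 : ∀ i ∈ Finset.range L, rr i = r := fun i hi => by
          simp [hrr, Finset.mem_range.1 hi]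
        have e3 : ∀ i ∈ Finset.range K, rr (L + 1 + i) = 1 := fun i hi => by
          have := Finset.mem_range.1 hi
          simp only [hrr]
          rw [if_neg (by omega), if_neg (by omega), if_pos (by omega)]
        have e4 : rr (L + 1 + K) = R := by
          simp only [hrr]
          rw [if_neg (by omega), if_neg (by omega), if_neg (by omega)]
        have e2 : rr L = R := by simp [hrr]
        rw [Finset.prod_congr rfl e1, Finset.prod_congr rfl e3, e4, e2]
        simp
      rw [hrprod, hprodE s] at hmom
      have hmark : ENNReal.ofReal y ^ θ * ∫⁻ z in U, W z ∂iidLaw m ≤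
          ENNReal.ofReal y ^ θ * (4⁻¹ * E) := by
        calc ENNReal.ofReal y ^ θ * ∫⁻ z in U, W z ∂iidLaw m
            = ∫⁻ z in U, ENNReal.ofReal y ^ θ * W z ∂iidLaw m :=
              (lintegral_const_mul _ hWm).symm
          _ ≤ ∫⁻ z in U, W z * ENNReal.ofReal (seqPerpetuity N z) ^ θ ∂iidLaw m := by
              refine setLIntegral_mono' hUm fun z hz => ?_
              rw [mul_comm]
              gcongr
              exact hz.le
          _ ≤ _ := setLIntegral_le_lintegral _ _
          _ ≤ _ := hmom
          _ ≤ ENNReal.ofReal y ^ θ * 4⁻¹ * E := by gcongr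
          _ = _ := mul_assoc _ _ _
      have hy0 : 0 < ENNReal.ofReal y := ENNReal.ofReal_pos.2 hy
      exact (ENNReal.mul_le_mul_iff_right (ENNReal.rpow_pos hy0 ENNReal.ofReal_ne_top).ne'
        (ENNReal.rpow_ne_top_of_nonneg hθ0.le ENNReal.ofReal_ne_top)).1 hmark
    · intro i
      have hadd : ∀ t : ℝ, 0 ≤ t → ∀ p : ℝ × ℝ, ENNReal.ofReal p.1 ^ t * ENNReal.ofReal p.1 ^ θ =
          ENNReal.ofReal p.1 ^ (t + θ) := fun t ht p =>
        (ENNReal.rpow_add_of_nonneg _ _ ht hθ0.le).symm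
      have hadd1 : ∀ p : ℝ × ℝ, ENNReal.ofReal p.1 * ENNReal.ofReal p.1 ^ θ =
          ENNReal.ofReal p.1 ^ (1 + θ) := fun p => by
        rw [← hadd 1 zero_le_one p, ENNReal.rpow_one]
      simp only [hrr, crossingWeight]
      split_ifs
      · simp only [hadd s (by linarith)]
        exact ha_s
      · rw [← hqL']
        refine le_trans (lintegral_mono fun p => ?_) ha_L
        rw [← hadd1]
        gcongr
        exact indicator_le_self' (fun _ _ => bot_le) _
      · simp only [hadd1, h1eq, one_mul]
        exact ha_1
      · rw [← hqB]; exact ha_B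
    · intro i
      simp only [crossingWeight]
      split_ifs
      · exact hb_s
      · rw [← hqL']
        refine le_trans (lintegral_mono fun p => ?_) hb_L
        gcongr
        exact indicator_le_self' (fun _ _ => bot_le) _
      · rw [h1eq]; exact hb_1
      · rw [← hqB]; exact hb_B
  -- the product is too small
  have hDle : ∫⁻ z in D, W z ∂iidLaw m ≤ 4⁻¹ * E := by
    -- Chernoff bound: on `D` a factor `π ^ θ` of the weight is at most `(x / b₁) ^ θ`, which lowers
    -- the tilt to `s - θ`.
    have hpt : ∀ᵐ z ∂iidLaw m, z ∈ D → W z ≤ ENNReal.ofReal (x / b₁) ^ θ *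
        ∏ i ∈ Finset.range N, crossingWeight (s - θ) b₁ L K i (z i) := by
      filter_upwards [hm] with z hz hzD
      simp only [hW]
      rw [hN, prod_crossingWeight s b₁ L K (fun i w => w (z i)),
        prod_crossingWeight (s - θ) b₁ L K (fun i w => w (z i)),
        ← mul_assoc (ENNReal.ofReal (x / b₁) ^ θ)]
      refine mul_le_mul' ?_ le_rfl
      have hsplit : ∏ i ∈ Finset.range L, ENNReal.ofReal (z i).1 ^ s =
          (∏ i ∈ Finset.range L, ENNReal.ofReal (z i).1) ^ θ *
            ∏ i ∈ Finset.range L, ENNReal.ofReal (z i).1 ^ (s - θ) := by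
        rw [← ENNReal.prod_rpow_of_nonneg hθ0.le, ← Finset.prod_mul_distrib]
        refine Finset.prod_congr rfl fun i _ => ?_
        rw [← ENNReal.rpow_add_of_nonneg _ _ hθ0.le (by linarith)]
        congr 1; ring
      rw [hsplit]
      gcongr
      rw [← ENNReal.ofReal_prod_of_nonneg fun i _ => (hz i).1]
      refine ENNReal.ofReal_le_ofReal ?_
      rw [le_div_iff₀ hb₁, mul_comm]
      exact hzD.le
    calc ∫⁻ z in D, W z ∂iidLaw m ≤ ∫⁻ z in D, ENNReal.ofReal (x / b₁) ^ θ *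
          ∏ i ∈ Finset.range N, crossingWeight (s - θ) b₁ L K i (z i) ∂iidLaw m :=
          setLIntegral_mono_ae' hDm hpt
      _ ≤ _ := setLIntegral_le_lintegral _ _
      _ = ENNReal.ofReal (x / b₁) ^ θ *
          (lawMoment m (s - θ) ^ L * (qL * lawMoment m 1 ^ K * qB)) := by
        rw [lintegral_const_mul, lintegral_iidLaw_prod m _ _
          (measurable_crossingWeight (s - θ) b₁ L K), hprodE]
        exact Finset.measurable_fun_prod _ fun i _ =>
          (measurable_crossingWeight (s - θ) b₁ L K i).comp (measurable_pi_apply i)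
      _ ≤ 4⁻¹ * E := by
        calc _ = ENNReal.ofReal (x / b₁) ^ θ * lawMoment m (s - θ) ^ L *
              (qL * lawMoment m 1 ^ K * qB) := (mul_assoc _ _ _).symm
          _ ≤ 4⁻¹ * lawMoment m s ^ L * (qL * lawMoment m 1 ^ K * qB) := by gcongr
          _ = _ := mul_assoc _ _ _
  have hsum : E ≤ (∫⁻ z in G, W z ∂iidLaw m) + (4⁻¹ * E + 4⁻¹ * E) := by
    have hcover : (univ : Set (ℕ → ℝ × ℝ)) ⊆ G ∪ (U ∪ D) := by
      intro z _
      by_cases h1 : z ∈ U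
      · exact Or.inr (Or.inl h1)
      by_cases h2 : z ∈ D
      · exact Or.inr (Or.inr h2)
      exact Or.inl ⟨not_lt.1 h2, not_lt.1 h1⟩
    calc E = ∫⁻ z in univ, W z ∂iidLaw m := by rw [setLIntegral_univ, hWE]
      _ ≤ ∫⁻ z in G ∪ (U ∪ D), W z ∂iidLaw m := lintegral_mono_set hcover
      _ ≤ _ := lintegral_union_le _ _ _
      _ ≤ _ := by
        gcongr
        exact (lintegral_union_le _ _ _).trans (add_le_add hUle hDle)
  -- Each bad event carries at most a quarter of the finite total weight `E`, so half of it remains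
  -- on `G`.
  have hhalf : 2⁻¹ * E ≤ ∫⁻ z in G, W z ∂iidLaw m := by
    have h4 : (4⁻¹ : ℝ≥0∞) + 4⁻¹ = 2⁻¹ := by
      rw [← two_mul, show (4 : ℝ≥0∞) = 2 * 2 by norm_num,
        ENNReal.mul_inv (by simp) (by simp), ← mul_assoc, ENNReal.mul_inv_cancel (by simp)
        (by simp), one_mul]
    rw [← add_mul, h4] at hsum
    have h2 : E = 2⁻¹ * E + 2⁻¹ * E := by rw [← add_mul, ENNReal.inv_two_add_inv_two, one_mul]
    nth_rewrite 1 [h2] at hsum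
    exact (ENNReal.add_le_add_iff_right
      (ENNReal.mul_ne_top (by simp) hE_top)).1 hsum
  have hSm : MeasurableSet {z | x ≤ seqPerpetuity (L + 1 + K) z ∧ seqPerpetuity N z ≤ y} :=
    (measurableSet_le measurable_const (measurable_seqPerpetuity _)).inter
      (measurableSet_le hYm measurable_const)
  calc ENNReal.ofReal ((y / b₁) ^ (1 - s)) * (2⁻¹ * E)
      ≤ ENNReal.ofReal ((y / b₁) ^ (1 - s)) * ∫⁻ z in G, W z ∂iidLaw m := by gcongr
    _ = ∫⁻ z in G, ENNReal.ofReal ((y / b₁) ^ (1 - s)) * W z ∂iidLaw m :=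
        (lintegral_const_mul _ hWm).symm
    _ ≤ ∫⁻ z in G, {z | x ≤ seqPerpetuity (L + 1 + K) z ∧ seqPerpetuity N z ≤ y}.indicator
        (fun z => ENNReal.ofReal (seqPerpetuity N z - seqPerpetuity (L + 1 + K) z))
        z ∂iidLaw m := by
        refine setLIntegral_mono_ae' hGm ?_
        filter_upwards [hm] with z hz hzG
        exact prod_crossingWeight_le_increment hz hs hb₁ hy L K hzG.1 hzG.2
    _ ≤ _ := setLIntegral_le_lintegral _ _
    _ = _ := lintegral_indicator hSm _

/-! ### Tangent inequalities for the cumulant generating function. -/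

section Cgf

variable {Ω : Type*} [MeasurableSpace Ω] {μ : Measure Ω} {X : Ω → ℝ} {s t : ℝ}

/-- Integrating the nonnegative `exp y - 1 - y`, with `y = (s - t) (X - Λ'(t))`, against `exp (t X)`
gives the tangent inequality, and strictness unless `X` is a.e. constant. Only `t` has to be
interior: `s` may be an endpoint of the integrability set, as `0` can be below. -/
lemma integral_exp_mul_sub_tangent (ht : t ∈ interior (integrableExpSet X μ))
    (hs : s ∈ integrableExpSet X μ) (hμ : μ ≠ 0) :
    Integrable (fun ω => Real.exp (t * X ω) * (Real.exp ((s - t) * (X ω - deriv (cgf X μ) t)) -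
      1 - (s - t) * (X ω - deriv (cgf X μ) t))) μ ∧
    ∫ ω, Real.exp (t * X ω) * (Real.exp ((s - t) * (X ω - deriv (cgf X μ) t)) - 1 -
      (s - t) * (X ω - deriv (cgf X μ) t)) ∂μ =
      Real.exp (-((s - t) * deriv (cgf X μ) t)) * mgf X μ s - mgf X μ t := by
  have hts : t ∈ integrableExpSet X μ := interior_subset ht
  have hpos : 0 < mgf X μ t := mgf_pos' hμ hts
  set r := deriv (cgf X μ) t with hr
  have hr' : ∫ ω, X ω * Real.exp (t * X ω) ∂μ = r * mgf X μ t := by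
    rw [hr, deriv_cgf ht, div_mul_cancel₀ _ hpos.ne']
  have i1 : Integrable (fun ω => Real.exp (s * X ω)) μ := hs
  have i2 : Integrable (fun ω => Real.exp (t * X ω)) μ := hts
  have i3 : Integrable (fun ω => X ω * Real.exp (t * X ω)) μ := by
    simpa using integrable_pow_mul_exp_of_mem_interior_integrableExpSet ht 1
  have hfun : ∀ ω, Real.exp (t * X ω) * (Real.exp ((s - t) * (X ω - r)) - 1 -
      (s - t) * (X ω - r)) = Real.exp (-((s - t) * r)) * Real.exp (s * X ω) -
      (1 - (s - t) * r) * Real.exp (t * X ω) - (s - t) * (X ω * Real.exp (t * X ω)) := by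
    intro ω
    have : Real.exp (t * X ω) * Real.exp ((s - t) * (X ω - r)) =
        Real.exp (-((s - t) * r)) * Real.exp (s * X ω) := by
      rw [← Real.exp_add, ← Real.exp_add]; congr 1; ring
    linear_combination this
  simp only [hfun]
  have i12 : Integrable (fun ω => Real.exp (-((s - t) * r)) * Real.exp (s * X ω) -
      (1 - (s - t) * r) * Real.exp (t * X ω)) μ := (i1.const_mul _).sub (i2.const_mul _)
  refine ⟨i12.sub (i3.const_mul _), ?_⟩
  rw [integral_sub i12 (i3.const_mul _), integral_sub (i1.const_mul _) (i2.const_mul _), integral_const_mul, integral_const_mul,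
    integral_const_mul, hr']
  simp only [mgf]
  ring

lemma exp_sub_tangent_nonneg (a x : ℝ) : 0 ≤ Real.exp a * (Real.exp x - 1 - x) :=
  mul_nonneg (Real.exp_pos _).le (by linarith [Real.add_one_le_exp x])

/-- The cumulant generating function lies above its tangents. -/
lemma cgf_add_deriv_mul_le (ht : t ∈ interior (integrableExpSet X μ))
    (hs : s ∈ integrableExpSet X μ) (hμ : μ ≠ 0) :
    cgf X μ t + deriv (cgf X μ) t * (s - t) ≤ cgf X μ s := by
  obtain ⟨-, h⟩ := integral_exp_mul_sub_tangent ht hs hμ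
  have h0 : 0 ≤ ∫ ω, Real.exp (t * X ω) * (Real.exp ((s - t) * (X ω - deriv (cgf X μ) t)) - 1 -
      (s - t) * (X ω - deriv (cgf X μ) t)) ∂μ :=
    integral_nonneg fun ω => exp_sub_tangent_nonneg _ _
  rw [h, Real.exp_neg] at h0
  have hle : mgf X μ t * Real.exp ((s - t) * deriv (cgf X μ) t) ≤ mgf X μ s := by
    rw [← le_div_iff₀ (Real.exp_pos _), div_eq_inv_mul]; linarith
  have hts : t ∈ integrableExpSet X μ := interior_subset ht
  have hpos : 0 < mgf X μ t := mgf_pos' hμ hts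
  have := Real.log_le_log (by positivity) hle
  rw [Real.log_mul hpos.ne' (Real.exp_pos _).ne', Real.log_exp, mul_comm] at this
  exact this

/-- The cumulant generating function of a nonconstant random variable lies strictly above its
tangents. -/
lemma cgf_add_deriv_mul_lt (ht : t ∈ interior (integrableExpSet X μ))
    (hs : s ∈ integrableExpSet X μ) (hX : ∀ c : ℝ, ¬ ∀ᵐ ω ∂μ, X ω = c) (hst : s ≠ t) :
    cgf X μ t + deriv (cgf X μ) t * (s - t) < cgf X μ s := by
  have hμ : μ ≠ 0 := by
    rintro rfl
    exact hX 0 (by simp)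
  obtain ⟨hi, h⟩ := integral_exp_mul_sub_tangent ht hs hμ
  have h0 : 0 < ∫ ω, Real.exp (t * X ω) * (Real.exp ((s - t) * (X ω - deriv (cgf X μ) t)) - 1 -
      (s - t) * (X ω - deriv (cgf X μ) t)) ∂μ := by
    refine lt_of_le_of_ne (integral_nonneg fun ω => exp_sub_tangent_nonneg _ _) fun h0 => ?_
    refine hX (deriv (cgf X μ) t) ?_
    filter_upwards [(integral_eq_zero_iff_of_nonneg
      (fun ω => exp_sub_tangent_nonneg _ _) hi).1 h0.symm] with ω hω
    by_contra hne
    have hx : (s - t) * (X ω - deriv (cgf X μ) t) ≠ 0 :=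
      mul_ne_zero (sub_ne_zero.2 hst) (sub_ne_zero.2 hne)
    have h1 := Real.add_one_lt_exp hx
    have h2 : Real.exp (t * X ω) * (Real.exp ((s - t) * (X ω - deriv (cgf X μ) t)) - 1 -
      (s - t) * (X ω - deriv (cgf X μ) t)) = 0 := hω
    rcases mul_eq_zero.1 h2 with h3 | h3
    · exact (Real.exp_pos _).ne' h3
    · linarith
  rw [h, Real.exp_neg] at h0
  have hle : mgf X μ t * Real.exp ((s - t) * deriv (cgf X μ) t) < mgf X μ s := by
    rw [← lt_div_iff₀ (Real.exp_pos _), div_eq_inv_mul]; linarith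
  have hts : t ∈ integrableExpSet X μ := interior_subset ht
  have hpos : 0 < mgf X μ t := mgf_pos' hμ hts
  have := Real.log_lt_log (by positivity) hle
  rw [Real.log_mul hpos.ne' (Real.exp_pos _).ne', Real.log_exp, mul_comm] at this
  exact this

end Cgf

/-! ### Moments of `A` as exponential moments of `log A`. -/

/-- The law of `(A, B)` restricted to `{A > 0}`. -/
abbrev posLaw (m : Measure (ℝ × ℝ)) : Measure (ℝ × ℝ) := m.restrict {p | 0 < p.1}

/-- `log A` as a function on the state space of `(A, B)`. -/
abbrev logFst (p : ℝ × ℝ) : ℝ := Real.log p.1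

lemma measurableSet_pos_fst : MeasurableSet {p : ℝ × ℝ | 0 < p.1} :=
  measurableSet_lt measurable_const measurable_fst

lemma measurable_logFst : Measurable logFst := Real.measurable_log.comp measurable_fst

lemma setLIntegral_pos_rpow (m : Measure (ℝ × ℝ)) (s : ℝ) :
    ∫⁻ p in {p : ℝ × ℝ | 0 < p.1}, ENNReal.ofReal p.1 ^ s ∂m =
      ∫⁻ p, ENNReal.ofReal (Real.exp (s * logFst p)) ∂posLaw m := by
  refine setLIntegral_congr_fun measurableSet_pos_fst fun p hp => ?_
  rw [ENNReal.ofReal_rpow_of_pos hp, Real.rpow_def_of_pos hp, mul_comm]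

/-- For `s > 0` the event `A = 0` contributes nothing to the moment. It must be removed before
passing to logarithms because `Real.log 0 = 0`. -/
lemma lawMoment_eq_lintegral_exp (m : Measure (ℝ × ℝ)) {s : ℝ} (hs : 0 < s) :
    lawMoment m s = ∫⁻ p, ENNReal.ofReal (Real.exp (s * logFst p)) ∂posLaw m := by
  rw [← setLIntegral_pos_rpow, ← lintegral_indicator measurableSet_pos_fst]
  refine lintegral_congr fun p => ?_
  by_cases hp : 0 < p.1
  · rw [indicator_of_mem (s := {p : ℝ × ℝ | 0 < p.1}) hp]
  · rw [indicator_of_notMem (s := {p : ℝ × ℝ | 0 < p.1}) hp, ENNReal.ofReal_of_nonpos (not_lt.1 hp),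
      ENNReal.zero_rpow_of_pos hs]

lemma measurable_exp_mul_logFst (s : ℝ) : Measurable fun p => Real.exp (s * logFst p) :=
  Real.measurable_exp.comp (measurable_logFst.const_mul s)

lemma ofReal_mgf_logFst {m : Measure (ℝ × ℝ)} {s : ℝ}
    (hs : s ∈ integrableExpSet logFst (posLaw m)) :
    ENNReal.ofReal (mgf logFst (posLaw m) s) =
      ∫⁻ p, ENNReal.ofReal (Real.exp (s * logFst p)) ∂posLaw m :=
  ofReal_integral_eq_lintegral_ofReal hs (ae_of_all _ fun _ => (Real.exp_pos _).le)

lemma mem_integrableExpSet_of_lawMoment {m : Measure (ℝ × ℝ)} {s : ℝ} (hs : lawMoment m s ≠ ∞) :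
    s ∈ integrableExpSet logFst (posLaw m) := by
  refine ⟨(measurable_exp_mul_logFst s).aestronglyMeasurable, ?_⟩
  rw [hasFiniteIntegral_iff_ofReal (ae_of_all _ fun _ => (Real.exp_pos _).le),
    ← setLIntegral_pos_rpow]
  exact (setLIntegral_le_lintegral _ _).trans_lt hs.lt_top

lemma toReal_lawMoment {m : Measure (ℝ × ℝ)} {s : ℝ} (hs0 : 0 < s) (hs : lawMoment m s ≠ ∞) :
    (lawMoment m s).toReal = mgf logFst (posLaw m) s := by
  rw [lawMoment_eq_lintegral_exp m hs0, ← ofReal_mgf_logFst (mem_integrableExpSet_of_lawMoment hs),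
    ENNReal.toReal_ofReal mgf_nonneg]

/-- At `s = 0` an atom at `A = 0` counts in `lawMoment` only, so equality may fail; the inequality
suffices to bound the conjugate. -/
lemma mgf_logFst_le_lawMoment {m : Measure (ℝ × ℝ)} {s : ℝ} (hs : lawMoment m s ≠ ∞) :
    mgf logFst (posLaw m) s ≤ (lawMoment m s).toReal := by
  rw [← ENNReal.ofReal_le_iff_le_toReal hs, ofReal_mgf_logFst
    (mem_integrableExpSet_of_lawMoment hs), ← setLIntegral_pos_rpow]
  exact setLIntegral_le_lintegral _ _

lemma rpow_mul_rpow_le (a b : ℝ≥0∞) {p q S : ℝ} (hp : 0 ≤ p) (hq : 0 ≤ q) (hpq : p + q ≤ S) :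
    a ^ p * b ^ q ≤ 1 + (a ^ S + b ^ S) := by
  have key : ∀ c : ℝ≥0∞, c ^ (p + q) ≤ 1 + c ^ S := by
    intro c
    rcases le_total c 1 with h | h
    · exact (ENNReal.rpow_le_one h (by linarith)).trans le_self_add
    · exact (ENNReal.rpow_le_rpow_of_exponent_le h hpq).trans le_add_self
  rcases le_total a b with h | h
  · calc a ^ p * b ^ q ≤ b ^ p * b ^ q := by gcongr
      _ = b ^ (p + q) := (ENNReal.rpow_add_of_nonneg _ _ hp hq).symm
      _ ≤ _ := (key b).trans (by gcongr; exact le_add_self)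
  · calc a ^ p * b ^ q ≤ a ^ p * a ^ q := by gcongr
      _ = a ^ (p + q) := (ENNReal.rpow_add_of_nonneg _ _ hp hq).symm
      _ ≤ _ := (key a).trans (by gcongr; exact le_self_add)

lemma lintegral_rpow_mul_rpow_ne_top {m : Measure (ℝ × ℝ)} [IsProbabilityMeasure m] {p q S : ℝ}
    (hA : lawMoment m S ≠ ∞) (hB : ∫⁻ p, ENNReal.ofReal p.2 ^ S ∂m ≠ ∞)
    (hp : 0 ≤ p) (hq : 0 ≤ q) (hpq : p + q ≤ S) :
    ∫⁻ x, ENNReal.ofReal x.1 ^ p * ENNReal.ofReal x.2 ^ q ∂m ≠ ∞ := by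
  refine ne_top_of_le_ne_top ?_ (lintegral_mono fun x => rpow_mul_rpow_le _ _ hp hq hpq)
  rw [lintegral_add_left measurable_const,
    lintegral_add_left (measurable_fst.ennreal_ofReal.pow_const _)]
  simp only [lintegral_const, measure_univ, mul_one]
  exact ENNReal.add_ne_top.2 ⟨ENNReal.one_ne_top, ENNReal.add_ne_top.2 ⟨hA, hB⟩⟩

lemma lawMoment_ne_top {m : Measure (ℝ × ℝ)} [IsProbabilityMeasure m] {s S : ℝ}
    (hA : lawMoment m S ≠ ∞) (hs : 0 ≤ s) (hsS : s ≤ S) : lawMoment m s ≠ ∞ := by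
  have h : ∀ c : ℝ≥0∞, c ^ s ≤ 1 + c ^ S := fun c => by
    rcases le_total c 1 with h | h
    · exact (ENNReal.rpow_le_one h hs).trans le_self_add
    · exact (ENNReal.rpow_le_rpow_of_exponent_le h hsS).trans le_add_self
  refine ne_top_of_le_ne_top ?_ (lintegral_mono fun x => h _)
  rw [lintegral_add_left measurable_const]
  simp only [lintegral_const, measure_univ, mul_one]
  exact ENNReal.add_ne_top.2 ⟨ENNReal.one_ne_top, hA⟩

lemma mem_interior_integrableExpSet {m : Measure (ℝ × ℝ)} [IsProbabilityMeasure m] {s S : ℝ}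
    (hA : lawMoment m S ≠ ∞) (hs : 0 < s) (hsS : s < S) :
    s ∈ interior (integrableExpSet logFst (posLaw m)) := by
  refine mem_interior.2 ⟨Ioo 0 S, fun t ht => ?_, isOpen_Ioo, hs, hsS⟩
  exact mem_integrableExpSet_of_lawMoment (lawMoment_ne_top hA ht.1.le ht.2.le)

section Density

variable {m : Measure (ℝ × ℝ)} {b₁ b₂ : ℝ} {ν : Measure ℝ} [IsFiniteMeasure ν] {g : ℝ → ℝ}

/-- The density component charges `{log A ≠ c}`, since a single value of `a` is Lebesgue-null. This
is the source of strict convexity. -/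
lemma HasDensityComponent.not_ae_eq_const (h : HasDensityComponent m b₁ b₂ ν g) (c : ℝ) :
    ¬ ∀ᵐ p ∂posLaw m, logFst p = c := by
  intro hc
  obtain ⟨κ, hκ, hle⟩ := h.exists_lintegral_le (x := 1) (y := 2) (by norm_num) (by norm_num)
  set f : ℝ × ℝ → ℝ≥0∞ := {p : ℝ × ℝ | 0 < p.1}.indicator
    (fun p => ({c}ᶜ : Set ℝ).indicator 1 (Real.log p.1)) with hf
  have hfm : Measurable f := Measurable.indicator
    ((measurable_one.indicator (measurableSet_singleton c).compl).comp measurable_logFst)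
    measurableSet_pos_fst
  have h0 : ∫⁻ p, f p ∂m = 0 := by
    rw [hf, lintegral_indicator measurableSet_pos_fst, lintegral_eq_zero_iff]
    · filter_upwards [hc] with p hp
      exact indicator_of_notMem (by simpa using hp) _
    · exact (measurable_one.indicator (measurableSet_singleton c).compl).comp measurable_logFst
  have h1 := (hle f hfm).trans (setLIntegral_le_lintegral _ _)
  rw [h0, nonpos_iff_eq_zero, mul_eq_zero] at h1
  have h2 := h1.resolve_left (by simpa using hκ)
  have h3 : ∀ b, (∫⁻ a in Icc (1 : ℝ) 2, f (a, b)) = 1 := by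
    intro b
    have hae : ∀ᵐ a ∂(volume : Measure ℝ), a ∈ Icc (1 : ℝ) 2 → f (a, b) = 1 := by
      filter_upwards [compl_mem_ae_iff.2 (measure_singleton (Real.exp c))] with a ha ha'
      have ha0 : 0 < a := by linarith [ha'.1]
      rw [hf, indicator_of_mem (s := {p : ℝ × ℝ | 0 < p.1}) (a := (a, b)) ha0,
        indicator_of_mem]
      · rfl
      · intro hlog
        exact ha (by rw [mem_singleton_iff, ← Real.exp_log ha0]; exact congrArg _ hlog)
    rw [setLIntegral_congr_fun_ae measurableSet_Icc hae]
    simp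
    norm_num
  simp only [h3, lintegral_one, Measure.measure_univ_eq_zero] at h2
  exact h.ne_zero h2

lemma HasDensityComponent.posLaw_ne_zero (h : HasDensityComponent m b₁ b₂ ν g) :
    posLaw m ≠ 0 := by
  intro h0
  exact h.not_ae_eq_const 0 (by simp [h0])

lemma HasDensityComponent.setLIntegral_fst_ne_zero (h : HasDensityComponent m b₁ b₂ ν g) :
    ∫⁻ p in {p : ℝ × ℝ | b₁ < p.2}, ENNReal.ofReal p.1 ∂m ≠ 0 := by
  intro h0
  obtain ⟨κ, hκ, hle⟩ := h.exists_lintegral_le (x := 1) (y := 2) (by norm_num) (by norm_num)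
  have h1 := (hle (fun p => ENNReal.ofReal p.1) measurable_fst.ennreal_ofReal).trans
    (lintegral_mono_set (t := {p : ℝ × ℝ | b₁ < p.2}) fun p hp => hp.2.1)
  rw [h0, nonpos_iff_eq_zero, mul_eq_zero] at h1
  have h2 := h1.resolve_left (by simpa using hκ)
  have h3 : ∀ b : ℝ, 1 ≤ ∫⁻ a in Icc (1 : ℝ) 2, ENNReal.ofReal ((a, b) : ℝ × ℝ).1 := by
    intro b
    calc (1 : ℝ≥0∞) = ∫⁻ _ in Icc (1 : ℝ) 2, (1 : ℝ≥0∞) := by simp; norm_num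
      _ ≤ _ := setLIntegral_mono' measurableSet_Icc fun a ha => by simpa using ha.1
  have h4 : ∫⁻ _, 1 ∂ν = 0 := le_antisymm ((lintegral_mono h3).trans h2.le) bot_le
  simp only [lintegral_one, Measure.measure_univ_eq_zero] at h4
  exact h.ne_zero h4

end Density

/-! ### Convexity of `Λ` and the better slope. -/

/-- `Λ(s) = log E[A ^ s]` as a real function. -/
abbrev lawCgf (m : Measure (ℝ × ℝ)) : ℝ → ℝ := cgf logFst (posLaw m)

section

variable {m : Measure (ℝ × ℝ)} [IsProbabilityMeasure m] {b₁ b₂ : ℝ} {ν : Measure ℝ}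
  [IsFiniteMeasure ν] {g : ℝ → ℝ} {S : ℝ}

lemma HasDensityComponent.lawMoment_eq (h : HasDensityComponent m b₁ b₂ ν g)
    (hA : lawMoment m S ≠ ∞) {s : ℝ} (hs : 0 < s) (hsS : s ≤ S) :
    lawMoment m s = ENNReal.ofReal (Real.exp (lawCgf m s)) := by
  have hfin := lawMoment_ne_top hA hs.le hsS
  rw [lawCgf, cgf, Real.exp_log (mgf_pos' h.posLaw_ne_zero (mem_integrableExpSet_of_lawMoment hfin)),
    ← toReal_lawMoment hs hfin,
    ENNReal.ofReal_toReal hfin]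

/-- A convex function with `Λ(α) < Λ(1)` cannot exceed `Λ(1)` between `1` and `α`. This keeps the
`θ`-th moment of the perpetuity from growing during the waiting phase. -/
lemma lawCgf_one_add_le (h : HasDensityComponent m b₁ b₂ ν g) (hA : lawMoment m S ≠ ∞) {α θ : ℝ}
    (hαS : α < S) (hlt : lawCgf m α < lawCgf m 1) (hθ0 : 0 < θ) (hθ : 1 + θ ≤ α) :
    lawCgf m (1 + θ) ≤ lawCgf m 1 := by
  have hint : 1 + θ ∈ interior (integrableExpSet logFst (posLaw m)) :=
    mem_interior_integrableExpSet hA (by linarith) (by linarith)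
  have h1 := cgf_add_deriv_mul_le hint (interior_subset (mem_interior_integrableExpSet hA
    (s := 1) (by norm_num) (by linarith))) h.posLaw_ne_zero
  have h2 := cgf_add_deriv_mul_le hint (interior_subset (mem_interior_integrableExpSet hA
    (s := α) (by linarith) hαS)) h.posLaw_ne_zero
  by_contra! hcon
  set r := deriv (cgf logFst (posLaw m)) (1 + θ)
  change cgf logFst (posLaw m) 1 < cgf logFst (posLaw m) (1 + θ) at hcon
  change cgf logFst (posLaw m) α < cgf logFst (posLaw m) 1 at hlt
  have hr : 0 < r := by nlinarith
  nlinarith [mul_nonneg hr.le (sub_nonneg.2 hθ)]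

/-- `Λ(α) < Λ(1)` forces `Λ'(1) < 0`, and the tangent at `1` evaluated at `0` lies below `Λ(0) ≤ 0`;
here `Λ(0)` is the log of the mass of `{A > 0}`. -/
lemma lawCgf_one_nonpos (h : HasDensityComponent m b₁ b₂ ν g) (hA : lawMoment m S ≠ ∞) {α : ℝ}
    (hα : 1 < α) (hαS : α < S) (hlt : lawCgf m α < lawCgf m 1) : lawCgf m 1 ≤ 0 := by
  have hint : 1 ∈ interior (integrableExpSet logFst (posLaw m)) :=
    mem_interior_integrableExpSet hA (by norm_num) (by linarith)
  have h1 := cgf_add_deriv_mul_le hint (interior_subset (mem_interior_integrableExpSet hA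
    (s := α) (by linarith) hαS)) h.posLaw_ne_zero
  have h0 : (0 : ℝ) ∈ integrableExpSet logFst (posLaw m) := by
    simp [integrableExpSet]
  have h2 := cgf_add_deriv_mul_le hint h0 h.posLaw_ne_zero
  have h3 : cgf logFst (posLaw m) 0 ≤ 0 := by
    refine Real.log_nonpos mgf_nonneg ?_
    rw [mgf_zero']
    rw [measureReal_restrict_apply_univ]
    exact measureReal_le_one
  set r := deriv (cgf logFst (posLaw m)) 1
  change cgf logFst (posLaw m) α < cgf logFst (posLaw m) 1 at hlt
  change cgf logFst (posLaw m) 1 ≤ 0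
  have hr : r < 0 := by nlinarith
  linarith

/-- Reaching the level faster, at slope `r > ρ`, and then spending the remaining time at the cost
`Λ(1)` per step improves the exponent. -/
lemma exists_better_slope (h : HasDensityComponent m b₁ b₂ ν g) (hA : lawMoment m S ≠ ∞)
    {α ρ : ℝ} (hρ : 0 < ρ) (hα : 1 < α) (hαS : α < S) (hder : deriv (lawCgf m) α = ρ)
    (hlt : lawCgf m α < lawCgf m 1) :
    ∃ s r, α < s ∧ s < S ∧ ρ < r ∧ HasDerivAt (lawCgf m) r s ∧
      -α + lawCgf m α / ρ < -s + lawCgf m s / r + lawCgf m 1 * (1 / ρ - 1 / r) := by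
  -- Inserting the tangent bound `Λ(α) + ρ (s - α) < Λ(s)`, the gain exceeds `(1/ρ - 1/r) (Λ(1) -
  -- Λ(α) - ρ (s - α))`, so `s - α` only has to be below the second term of the minimum.
  set η := min (S - α) ((lawCgf m 1 - lawCgf m α) / ρ) with hη
  have hη0 : 0 < η := lt_min (by linarith) (div_pos (by linarith) hρ)
  set s := α + η / 2 with hs
  have hsα : α < s := by linarith
  have hsS : s < S := by
    have := min_le_left (S - α) ((lawCgf m 1 - lawCgf m α) / ρ)
    linarith
  have hgap : (s - α) * ρ < lawCgf m 1 - lawCgf m α := by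
    have h1 := min_le_right (S - α) ((lawCgf m 1 - lawCgf m α) / ρ)
    rw [← lt_div_iff₀ hρ]
    linarith
  have hiα : α ∈ interior (integrableExpSet logFst (posLaw m)) :=
    mem_interior_integrableExpSet hA (by linarith) hαS
  have his : s ∈ interior (integrableExpSet logFst (posLaw m)) :=
    mem_interior_integrableExpSet hA (by linarith) hsS
  set r := deriv (lawCgf m) s with hr
  have t1 := cgf_add_deriv_mul_lt hiα (interior_subset his) h.not_ae_eq_const hsα.ne'
  have t2 := cgf_add_deriv_mul_le his (interior_subset hiα) h.posLaw_ne_zero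
  change lawCgf m α + deriv (lawCgf m) α * (s - α) < lawCgf m s at t1
  change lawCgf m s + r * (α - s) ≤ lawCgf m α at t2
  rw [hder] at t1
  have hρr : ρ < r := by
    have : ρ * (s - α) < r * (s - α) := by linarith
    exact lt_of_mul_lt_mul_right this (by linarith)
  have hr0 : 0 < r := hρ.trans hρr
  refine ⟨s, r, hsα, hsS, hρr, (analyticAt_cgf his).differentiableAt.hasDerivAt, ?_⟩
  have hinv : 0 < 1 / ρ - 1 / r := by
    rw [sub_pos]; exact one_div_lt_one_div_of_lt hρ hρr
  have h3 : lawCgf m α / ρ = lawCgf m α * (1 / ρ - 1 / r) + lawCgf m α / r := by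
    field_simp; ring
  have h4 : (lawCgf m α + ρ * (s - α)) / r < lawCgf m s / r := div_lt_div_of_pos_right t1 hr0
  have h5 : (lawCgf m α + ρ * (s - α)) / r = lawCgf m α / r + (s - α) -
      (s - α) * ρ * (1 / ρ - 1 / r) := by
    field_simp; ring
  have h6 := mul_lt_mul_of_pos_right hgap hinv
  rw [h3]
  linarith

end

/-! ### Exponential form of the lower bound. -/

lemma exists_small_increment {f : ℝ → ℝ} {r s κ θ₀ : ℝ} (hf : HasDerivAt f r s) (hκ : 0 < κ)
    (hθ₀ : 0 < θ₀) :
    ∃ θ, 0 < θ ∧ θ < θ₀ ∧ f (s + θ) ≤ f s + θ * (r + κ) ∧ f (s - θ) ≤ f s - θ * (r - κ) := by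
  have h := (hasDerivAt_iff_isLittleO_nhds_zero.1 hf).bound hκ
  obtain ⟨e, he, hball⟩ := Metric.eventually_nhds_iff.1 h
  set θ := min e θ₀ / 2 with hθ
  have hm : 0 < min e θ₀ := lt_min he hθ₀
  have hθ0 : 0 < θ := by positivity
  have hθe : θ < e := by have := min_le_left e θ₀; linarith
  have hθθ : θ < θ₀ := by have := min_le_right e θ₀; linarith
  have h1 := hball (y := θ) (by simpa [abs_of_pos hθ0] using hθe)
  have h2 := hball (y := -θ) (by simpa [abs_of_pos hθ0] using hθe)
  simp only [Real.norm_eq_abs, abs_neg, abs_of_pos hθ0, smul_eq_mul] at h1 h2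
  refine ⟨θ, hθ0, hθθ, ?_, ?_⟩
  · linarith [(abs_le.1 h1).2]
  · rw [← sub_eq_add_neg] at h2
    linarith [(abs_le.1 h2).2]

lemma ofReal_exp_pow (x : ℝ) (n : ℕ) :
    ENNReal.ofReal (Real.exp x) ^ n = ENNReal.ofReal (Real.exp (n * x)) := by
  rw [← ENNReal.ofReal_pow (Real.exp_pos _).le, ← Real.exp_nat_mul]

lemma ofReal_exp_rpow (x θ : ℝ) :
    ENNReal.ofReal (Real.exp x) ^ θ = ENNReal.ofReal (Real.exp (x * θ)) := by
  rw [ENNReal.ofReal_rpow_of_pos (Real.exp_pos _), ← Real.exp_mul]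

lemma four_inv_eq_ofReal_exp : (4⁻¹ : ℝ≥0∞) = ENNReal.ofReal (Real.exp (-Real.log 4)) := by
  rw [Real.exp_neg, Real.exp_log (by norm_num), ENNReal.ofReal_inv_of_pos (by norm_num)]
  norm_num

section

variable {m : Measure (ℝ × ℝ)} [IsProbabilityMeasure m] {b₁ b₂ : ℝ} {ν : Measure ℝ}
  [IsFiniteMeasure ν] {g : ℝ → ℝ} {S : ℝ}

/-- For suitable `θ`, a lower bound for the integrated crossing probability in exponential form. -/
lemma exists_le_setLIntegral_crossingProb (h : HasDensityComponent m b₁ b₂ ν g)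
    (hm : ∀ᵐ z ∂iidLaw m, ∀ i, 0 ≤ (z i).1 ∧ 0 < (z i).2) (hA : lawMoment m S ≠ ∞)
    (hB : ∫⁻ p, ENNReal.ofReal p.2 ^ S ∂m ≠ ∞) {α s r κ : ℝ} (hα : 1 < α) (hαs : α < s)
    (hsS : s < S) (hlt : lawCgf m α < lawCgf m 1) (hr : 0 < r) (hder : HasDerivAt (lawCgf m) r s)
    (hκ : 0 < κ) :
    ∃ θ M Q : ℝ, 0 < θ ∧ 0 < M ∧ 0 < Q ∧ ∀ (L K : ℕ) (ξ ζ : ℝ),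
      (ξ - Real.log b₁) - L * (r - κ) ≤ -(Real.log 4 / θ) →
      ((L + 1 + K + 1 : ℕ) : ℝ) * M * Real.exp (L * (θ * (r + κ))) ≤
        Real.exp (ζ * θ) / 4 →
      ENNReal.ofReal (Q * Real.exp ((ζ - Real.log b₁) * (1 - s) + L * lawCgf m s +
          K * lawCgf m 1)) ≤
        ∫⁻ v in Icc (Real.exp ξ) (Real.exp ζ), crossingProb m (L + 1 + K) v := by
  -- `θ ≤ 1` is for subadditivity, `θ ≤ α - 1` for `Λ(1 + θ) ≤ Λ(1)`, and `θ ≤ S - s` for finiteness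
  -- of the mixed moments.
  obtain ⟨θ, hθ0, hθlt, hup, hdown⟩ := exists_small_increment hder hκ
    (θ₀ := min 1 (min (α - 1) (S - s))) (lt_min one_pos (lt_min (by linarith) (by linarith)))
  have hθ1 : θ ≤ 1 := (hθlt.trans_le (min_le_left _ _)).le
  have hθα : θ ≤ α - 1 :=
    (hθlt.trans_le ((min_le_right _ _).trans (min_le_left _ _))).le
  have hθS : θ ≤ S - s :=
    (hθlt.trans_le ((min_le_right _ _).trans (min_le_right _ _))).le
  set qL := ∫⁻ p in {p : ℝ × ℝ | b₁ < p.2}, ENNReal.ofReal p.1 ∂m with hqL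
  set qB := ∫⁻ p, ENNReal.ofReal p.2 ∂m with hqB
  have hqL0 : qL ≠ 0 := h.setLIntegral_fst_ne_zero
  have hqB0 : qB ≠ 0 := by
    intro h0
    rw [hqB, lintegral_eq_zero_iff measurable_snd.ennreal_ofReal] at h0
    have h1 : ∀ᵐ p ∂m, 0 < p.2 := by
      have hmp := measurePreserving_eval_infinitePi (fun _ : ℕ => m) 0
      rw [← hmp.map_eq, ae_map_iff hmp.measurable.aemeasurable
        (measurableSet_lt measurable_const measurable_snd)]
      exact hm.mono fun z hz => (hz 0).2
    have h2 : ∀ᵐ p ∂m, False := by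
      filter_upwards [h0, h1] with p hp hp'
      have : ENNReal.ofReal p.2 = 0 := hp
      rw [ENNReal.ofReal_eq_zero] at this
      linarith
    exact IsProbabilityMeasure.ne_zero m (by simpa using h2)
  have hmix : ∀ {p q : ℝ}, 0 ≤ p → 0 ≤ q → p + q ≤ S →
      ∫⁻ x, ENNReal.ofReal x.1 ^ p * ENNReal.ofReal x.2 ^ q ∂m ≠ ∞ :=
    fun hp hq hpq => lintegral_rpow_mul_rpow_ne_top hA hB hp hq hpq
  have h1_top : lawMoment m 1 ≠ ∞ := lawMoment_ne_top hA zero_le_one (by linarith)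
  have hs_top : lawMoment m s ≠ ∞ := lawMoment_ne_top hA (by linarith) hsS.le
  have h1θ_top : lawMoment m (1 + θ) ≠ ∞ := lawMoment_ne_top hA (by linarith) (by linarith)
  have hqL_top : qL ≠ ∞ := by
    refine ne_top_of_le_ne_top h1_top ((setLIntegral_le_lintegral _ _).trans (le_of_eq ?_))
    simp [lawMoment]
  have hqB_top : qB ≠ ∞ := by
    have := hmix (p := 0) (q := 1) le_rfl zero_le_one (by linarith)
    simpa using this
  set IB := ∫⁻ p, ENNReal.ofReal p.2 * ENNReal.ofReal p.1 ^ θ ∂m with hIB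
  set Is := ∫⁻ p, ENNReal.ofReal p.1 ^ s * ENNReal.ofReal p.2 ^ θ ∂m with hIs
  set I1 := ∫⁻ p, ENNReal.ofReal p.1 * ENNReal.ofReal p.2 ^ θ ∂m with hI1
  set I2 := ∫⁻ p, ENNReal.ofReal p.2 * ENNReal.ofReal p.2 ^ θ ∂m with hI2
  have hIB_top : IB ≠ ∞ := by
    have := hmix (p := θ) (q := 1) hθ0.le zero_le_one (by linarith)
    simpa [mul_comm] using this
  have hIs_top : Is ≠ ∞ := hmix (by linarith) hθ0.le (by linarith)
  have hI1_top : I1 ≠ ∞ := by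
    have := hmix (p := 1) (q := θ) zero_le_one hθ0.le (by linarith)
    simpa using this
  have hI2_top : I2 ≠ ∞ := by
    have := hmix (p := 0) (q := 1 + θ) le_rfl (by linarith) (by linarith)
    simpa [ENNReal.rpow_add_of_nonneg 1 θ zero_le_one hθ0.le] using this
  have eqs := fun {p : ℝ} (hp : 0 < p) (hpS : p ≤ S) => h.lawMoment_eq hA hp hpS
  have h10 : lawMoment m 1 ≠ 0 := by
    rw [eqs one_pos (by linarith)]; simp [Real.exp_pos]
  have hs0 : lawMoment m s ≠ 0 := by
    rw [eqs (by linarith) hsS.le]; simp [Real.exp_pos]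
  -- `R` and `C` are sums of all the ratios they have to dominate, plus 1 so that both are at least
  -- 1.
  set R : ℝ≥0∞ := 1 + (lawMoment m (1 + θ) / qL + IB / qB) with hR
  set C : ℝ≥0∞ := 1 + (Is / lawMoment m s + I1 / lawMoment m 1 + (I1 / qL + I2 / qB)) with hC
  have hR_top : R ≠ ∞ := by
    simp only [hR, ne_eq, ENNReal.add_eq_top, not_or]
    exact ⟨ENNReal.one_ne_top, ENNReal.div_ne_top h1θ_top hqL0, ENNReal.div_ne_top hIB_top hqB0⟩
  have hC_top : C ≠ ∞ := by
    simp only [hC, ne_eq, ENNReal.add_eq_top, not_or]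
    exact ⟨ENNReal.one_ne_top, ⟨ENNReal.div_ne_top hIs_top hs0, ENNReal.div_ne_top hI1_top h10⟩,
      ENNReal.div_ne_top hI1_top hqL0, ENNReal.div_ne_top hI2_top hqB0⟩
  have hdiv : ∀ {a q T : ℝ≥0∞}, q ≠ 0 → q ≠ ∞ → a / q ≤ T → a ≤ T * q :=
    fun {a q T} hq hq' hle => (ENNReal.div_le_iff hq hq').1 hle
  have hM_top : C * (R * R) ≠ ∞ := ENNReal.mul_ne_top hC_top (ENNReal.mul_ne_top hR_top hR_top)
  have hM1 : 1 ≤ C * (R * R) := one_le_mul le_self_add (one_le_mul le_self_add le_self_add)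
  have hM0 : 0 < (C * (R * R)).toReal :=
    ENNReal.toReal_pos (zero_lt_one.trans_le hM1).ne' hM_top
  have hQ0 : 0 < (2⁻¹ * (qL * qB)).toReal := ENNReal.toReal_pos
    (mul_ne_zero (by simp) (mul_ne_zero hqL0 hqB0))
    (ENNReal.mul_ne_top (by simp) (ENNReal.mul_ne_top hqL_top hqB_top))
  refine ⟨θ, (C * (R * R)).toReal, (2⁻¹ * (qL * qB)).toReal, hθ0, hM0, hQ0,
    fun L K ξ ζ hξ hζ => ?_⟩
  have hb₁ := h.pos
  have hdivexp : ∀ x, Real.exp x / b₁ = Real.exp (x - Real.log b₁) := fun x => by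
    rw [Real.exp_sub, Real.exp_log hb₁]
  have main := le_lintegral_increment m hm (s := s) (θ := θ) (b₁ := b₁) (x := Real.exp ξ)
    (y := Real.exp ζ) (by linarith) hθ0 hθ1 hb₁ (Real.exp_pos _) L K
    (ENNReal.ofReal (Real.exp (θ * (r + κ)))) R C qL qB hqL hqB hqL_top hqB_top hs_top h1_top
    (by rw [ENNReal.one_le_ofReal]; exact Real.one_le_exp (by positivity)) le_self_add
    (by
      rw [eqs (by linarith) (by linarith), eqs (by linarith) hsS.le,
        ← ENNReal.ofReal_mul (Real.exp_pos _).le, ← Real.exp_add]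
      exact ENNReal.ofReal_le_ofReal (Real.exp_le_exp.2 (by linarith)))
    (by
      rw [eqs (by linarith) (by linarith), eqs one_pos (by linarith)]
      exact ENNReal.ofReal_le_ofReal (Real.exp_le_exp.2
        (lawCgf_one_add_le h hA (by linarith) hlt hθ0 (by linarith))))
    (hdiv hqL0 hqL_top (le_self_add.trans le_add_self))
    (hdiv hqB0 hqB_top (le_add_self.trans le_add_self))
    (hdiv hs0 hs_top ((le_self_add.trans le_self_add).trans le_add_self))
    (hdiv h10 h1_top ((le_add_self.trans le_self_add).trans le_add_self))
    (hdiv hqL0 hqL_top ((le_self_add.trans le_add_self).trans le_add_self))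
    (hdiv hqB0 hqB_top ((le_add_self.trans le_add_self).trans le_add_self))
    (by
      rw [eqs (by linarith) (by linarith), eqs (by linarith) hsS.le, hdivexp, ofReal_exp_rpow,
        ofReal_exp_pow, ofReal_exp_pow, four_inv_eq_ofReal_exp,
        ← ENNReal.ofReal_mul (Real.exp_pos _).le, ← ENNReal.ofReal_mul (Real.exp_pos _).le,
        ← Real.exp_add, ← Real.exp_add]
      refine ENNReal.ofReal_le_ofReal (Real.exp_le_exp.2 ?_)
      have h1 := mul_le_mul_of_nonneg_right hξ hθ0.le
      have h2 : -(Real.log 4 / θ) * θ = -Real.log 4 := by field_simp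
      have h3 := mul_le_mul_of_nonneg_left hdown (Nat.cast_nonneg (α := ℝ) L)
      linarith)
    (by
      rw [ofReal_exp_rpow, ofReal_exp_pow]
      have h4 : (4⁻¹ : ℝ≥0∞) = ENNReal.ofReal (4⁻¹) := by
        rw [ENNReal.ofReal_inv_of_pos (by norm_num)]; norm_num
      calc _ = ((L + 1 + K + 1 : ℕ) : ℝ≥0∞) * (C * (R * R)) *
            ENNReal.ofReal (Real.exp (L * (θ * (r + κ)))) := by ring
        _ = ENNReal.ofReal (((L + 1 + K + 1 : ℕ) : ℝ) * (C * (R * R)).toReal *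
            Real.exp (L * (θ * (r + κ)))) := by
          rw [ENNReal.ofReal_mul (by positivity), ENNReal.ofReal_mul (by positivity),
            ENNReal.ofReal_natCast, ENNReal.ofReal_toReal hM_top]
        _ ≤ ENNReal.ofReal (Real.exp (ζ * θ) / 4) := ENNReal.ofReal_le_ofReal hζ
        _ = _ := by rw [h4, ← ENNReal.ofReal_mul (Real.exp_pos _).le, div_eq_mul_inv])
  refine le_trans (le_of_eq ?_)
    (main.trans (lintegral_increment_le_setLIntegral_crossingProb m _ _ _))
  rw [hdivexp, eqs (by linarith) hsS.le, eqs one_pos (by linarith), ofReal_exp_pow, ofReal_exp_pow,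
    ← Real.exp_mul, Real.exp_add, Real.exp_add, ENNReal.ofReal_mul hQ0.le,
    ENNReal.ofReal_mul (by positivity), ENNReal.ofReal_mul (by positivity),
    ENNReal.ofReal_toReal (ENNReal.mul_ne_top (by simp) (ENNReal.mul_ne_top hqL_top hqB_top))]
  ring

end

/-! ### Choice of the lengths of the climbing, waiting and steering phases. -/

/-- Up to subexponential errors, the crossing probability at time `⌊t / ρ⌋ - 1` and level `exp t` is
at least the probability of reaching the level at slope `r > ρ` times the cost of waiting. -/
lemma eventually_le_crossingProb {m : Measure (ℝ × ℝ)} [IsProbabilityMeasure m] {b₁ b₂ : ℝ}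
    {ν : Measure ℝ} [IsFiniteMeasure ν] {g : ℝ → ℝ} {S : ℝ}
    (h : HasDensityComponent m b₁ b₂ ν g)
    (hm : ∀ᵐ z ∂iidLaw m, ∀ i, 0 ≤ (z i).1 ∧ 0 < (z i).2) (hA : lawMoment m S ≠ ∞)
    (hB : ∫⁻ p, ENNReal.ofReal p.2 ^ S ∂m ≠ ∞) {α s r ρ η : ℝ} (hα : 1 < α) (hαs : α < s)
    (hsS : s < S) (hlt : lawCgf m α < lawCgf m 1) (hρ : 0 < ρ) (hρr : ρ < r)
    (hder : HasDerivAt (lawCgf m) r s) (hη : 0 < η) :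
    ∀ᶠ t : ℝ in atTop,
      ENNReal.ofReal (Real.exp (t * (-s + lawCgf m s / r + lawCgf m 1 * (1 / ρ - 1 / r) - η))) ≤
        crossingProb m (⌊t / ρ⌋₊ - 1) (Real.exp t) := by
  have hr : 0 < r := hρ.trans hρr
  have hinv : 0 < 1 / ρ - 1 / r := by
    rw [sub_pos]; exact one_div_lt_one_div_of_lt hρ hρr
  have hΛ1 : lawCgf m 1 ≤ 0 := lawCgf_one_nonpos h hA hα (by linarith) hlt
  obtain ⟨c, hc, hsteer⟩ := h.exists_setLIntegral_le_crossingProb_add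
  have hl2 : 1 / 2 ≤ Real.log 2 := by linarith [Real.log_two_gt_d9]
  have hl2' : Real.log 2 ≤ 1 := by linarith [Real.log_two_lt_d9]
  -- `D` bounds the loss per steering step: `log c` from the steering, `(s - 1) log 2` from the
  -- wider window through the factor `(y / b₁) ^ (1 - s)`.
  set D : ℝ := |Real.log c| + (s - 1) * Real.log 2 + 1 with hD
  have hD0 : 0 < D := by
    have := mul_nonneg (by linarith : (0 : ℝ) ≤ s - 1) (by linarith : 0 ≤ Real.log 2)
    have := abs_nonneg (Real.log c)
    linarith
  -- With about `κ t` steering steps, the three bounds ensure `4 ^ j ≤ exp (t / 2)`, leave time for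
  -- the waiting phase, and keep the total steering loss below `η t / 2`.
  set κ : ℝ := min (1 / 4) (min ((1 / ρ - 1 / r) / 2) (η / (2 * D))) with hκdef
  have hκ0 : 0 < κ := by
    refine lt_min (by norm_num) (lt_min (by linarith) (by positivity))
  have hκ4 : κ ≤ 1 / 4 := min_le_left _ _
  have hκinv : κ ≤ (1 / ρ - 1 / r) / 2 := (min_le_right _ _).trans (min_le_left _ _)
  have hκη : κ * D ≤ η / 2 := by
    have : κ ≤ η / (2 * D) := (min_le_right _ _).trans (min_le_right _ _)
    rw [le_div_iff₀ (by positivity)] at this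
    linarith
  -- Slope error `κ r / 4` over `t / r` steps shifts the log-level by `κ t / 4`, while the window
  -- has half-width at least `κ t / 2`. The remaining `κ t / 4` absorbs constants and the polynomial
  -- factor `N`.
  obtain ⟨θ, M, Q, hθ0, hM0, hQ0, hint⟩ := exists_le_setLIntegral_crossingProb h hm hA hB hα hαs
    hsS hlt hr hder (κ := κ * r / 4) (by positivity)
  have e1 : ∀ᶠ t : ℝ in atTop, 4 * M * (t / ρ) ≤ Real.exp (θ * κ / 4 * t) := by
    have := isLittleO_pow_exp_pos_mul_atTop 1 (by positivity : 0 < θ * κ / 4)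
    simp only [pow_one] at this
    have hpos : 0 < ρ / (4 * M) := by positivity
    filter_upwards [this.bound hpos, eventually_ge_atTop 0] with t ht ht0
    rw [Real.norm_of_nonneg ht0, Real.norm_of_nonneg (Real.exp_pos _).le] at ht
    have h2 : 4 * M * (t / ρ) = t / (ρ / (4 * M)) := by field_simp
    rw [h2, div_le_iff₀ hpos]
    linarith
  have e2 : ∀ᶠ t : ℝ in atTop, 2 * b₂ ≤ Real.exp (t / 2) :=
    (Real.tendsto_exp_atTop.comp (tendsto_id.atTop_div_const (by norm_num))).eventually_ge_atTop _
  have lin : ∀ a b : ℝ, 0 < a → ∀ᶠ t : ℝ in atTop, b ≤ a * t := fun a b ha =>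
    (tendsto_id.const_mul_atTop ha).eventually_ge_atTop b
  filter_upwards [e1, e2, eventually_ge_atTop 0, lin ((1 / ρ - 1 / r) / 2) 4 (by linarith),
    lin (κ / 4) (r + -Real.log b₁ + Real.log 4 / θ) (by positivity),
    lin (η / 2) (|Real.log c| + 2 * ((s - 1) * Real.log 2) - (s - 1) * Real.log b₁ +
      |lawCgf m s| - lawCgf m 1 - Real.log Q) (by positivity)] with t h1 h2 h0 h3 h4 h5
  set n := ⌊t / ρ⌋₊ with hn
  set L := ⌊t / r⌋₊ with hL
  set j := ⌊κ * t⌋₊ with hj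
  have hn1 : (n : ℝ) ≤ t / ρ := Nat.floor_le (by positivity)
  have hn2 : t / ρ < n + 1 := Nat.lt_floor_add_one _
  have hL1 : (L : ℝ) ≤ t / r := Nat.floor_le (by positivity)
  have hL2 : t / r < L + 1 := Nat.lt_floor_add_one _
  have hj1 : (j : ℝ) ≤ κ * t := Nat.floor_le (by positivity)
  have hj2 : κ * t < j + 1 := Nat.lt_floor_add_one _
  have hdiff : (1 / ρ - 1 / r) * t = t / ρ - t / r := by ring
  have hκt : κ * t ≤ (1 / ρ - 1 / r) / 2 * t := by gcongr
  have hle : L + j + 3 ≤ n := by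
    have : (L : ℝ) + j + 3 ≤ n := by linarith
    exact_mod_cast this
  obtain ⟨K, hK⟩ := Nat.exists_eq_add_of_le hle
  have hKr : (n : ℝ) = L + j + 3 + K := by rw [hK]; push_cast; ring
  -- Time budget: `L` climbing steps, one step with `B > b₁`, `K` waiting steps and `j + 1` steering
  -- steps; the crossing itself is step `n`.
  have hk : n - 1 = L + 1 + K + (j + 1) := by omega
  have hu : Real.exp t / 2 ^ (j + 2) = Real.exp (t - (j + 2) * Real.log 2) := by
    rw [Real.exp_sub, show ((j : ℝ) + 2) * Real.log 2 = ((j + 2 : ℕ) : ℝ) * Real.log 2 by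
      push_cast; ring, Real.exp_nat_mul, Real.exp_log two_pos]
  have hu' : 2 ^ (j + 2) * Real.exp t = Real.exp (t + (j + 2) * Real.log 2) := by
    rw [Real.exp_add, show ((j : ℝ) + 2) * Real.log 2 = ((j + 2 : ℕ) : ℝ) * Real.log 2 by
      push_cast; ring, Real.exp_nat_mul, Real.exp_log two_pos, mul_comm]
  have hjl : κ * t / 2 ≤ (j + 2) * Real.log 2 := by
    have := mul_le_mul (show κ * t ≤ j + 2 by linarith) hl2 (by norm_num) (by positivity)
    linarith
  have hjl' : (j + 2) * Real.log 2 ≤ (κ * t + 2) * Real.log 2 := by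
    gcongr
  have hI := hint L K (t - (j + 2) * Real.log 2) (t + (j + 2) * Real.log 2) (by
      have hrκ : 0 ≤ r - κ * r / 4 := by
        have := mul_le_mul_of_nonneg_right hκ4 hr.le
        linarith
      have ha := mul_le_mul_of_nonneg_right hL2.le hrκ
      have hb : t / r * (r - κ * r / 4) = t - κ * t / 4 := by field_simp
      have hκr : 0 < κ * r := by positivity
      linarith) (by
      have hN : ((L + 1 + K + 1 : ℕ) : ℝ) ≤ t / ρ := by
        push_cast; linarith [Nat.cast_nonneg (α := ℝ) j]
      have hE : Real.exp (L * (θ * (r + κ * r / 4))) ≤ Real.exp (θ * t + θ * κ / 4 * t) := by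
        rw [Real.exp_le_exp]
        calc (L : ℝ) * (θ * (r + κ * r / 4)) ≤ t / r * (θ * (r + κ * r / 4)) := by gcongr
          _ = _ := by field_simp
      have hE2 : Real.exp (θ * κ / 4 * t) * Real.exp (θ * t + θ * κ / 4 * t) ≤
          Real.exp ((t + (j + 2) * Real.log 2) * θ) := by
        rw [← Real.exp_add, Real.exp_le_exp]
        have := mul_le_mul_of_nonneg_right hjl hθ0.le
        linarith
      calc ((L + 1 + K + 1 : ℕ) : ℝ) * M * Real.exp (L * (θ * (r + κ * r / 4)))
          ≤ t / ρ * M * Real.exp (θ * t + θ * κ / 4 * t) := by gcongr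
        _ = (4 * M * (t / ρ)) * Real.exp (θ * t + θ * κ / 4 * t) / 4 := by ring
        _ ≤ Real.exp (θ * κ / 4 * t) * Real.exp (θ * t + θ * κ / 4 * t) / 4 := by gcongr
        _ ≤ _ := by gcongr)
  have hS := hsteer j (L + 1 + K) (Real.exp t) (Real.exp_pos _) (by
    have h4j : (4 : ℝ) ^ j ≤ Real.exp (t / 2) := by
      rw [show (4 : ℝ) = Real.exp (Real.log 4) by rw [Real.exp_log (by norm_num)],
        ← Real.exp_nat_mul, Real.exp_le_exp,
        show (4 : ℝ) = 2 ^ 2 by norm_num, Real.log_pow]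
      push_cast
      have := mul_le_mul_of_nonneg_right hκ4 h0
      have h6 : (j : ℝ) * (2 * Real.log 2) ≤ j * (2 * 1) := by gcongr
      linarith
    have : Real.exp t = Real.exp (t / 2) * Real.exp (t / 2) := by
      rw [← Real.exp_add]; congr 1; ring
    rw [this]
    gcongr)
  rw [hu, hu'] at hS
  rw [hk]
  refine le_trans ?_ hS
  refine le_trans ?_ (mul_le_mul_right hI _)
  rw [← ENNReal.ofReal_mul (by positivity)]
  refine ENNReal.ofReal_le_ofReal ?_
  rw [show c ^ (j + 1) = Real.exp ((j + 1) * Real.log c) by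
      rw [show ((j : ℝ) + 1) * Real.log c = ((j + 1 : ℕ) : ℝ) * Real.log c by push_cast; ring,
        Real.exp_nat_mul, Real.exp_log hc],
    ← Real.exp_sub, ← Real.exp_log hQ0, ← Real.exp_add, ← Real.exp_add, Real.exp_le_exp]
  have f1 : -(κ * t * |Real.log c|) - |Real.log c| ≤ (j + 1) * Real.log c := by
    have h6 : (j + 1) * -Real.log c ≤ (j + 1) * |Real.log c| := by
      gcongr
      exact neg_le_abs _
    have h7 : (j + 1) * |Real.log c| ≤ (κ * t + 1) * |Real.log c| := by gcongr
    linarith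
  have f2 : (s - 1) * ((j + 2) * Real.log 2) ≤ (s - 1) * ((κ * t + 2) * Real.log 2) :=
    mul_le_mul_of_nonneg_left hjl' (by linarith)
  have f3 : t / r * lawCgf m s - |lawCgf m s| ≤ L * lawCgf m s := by
    have ha : |(t / r - L) * lawCgf m s| ≤ 1 * |lawCgf m s| := by
      rw [abs_mul]
      gcongr
      rw [abs_le]; constructor <;> linarith
    have := (abs_le.1 ha).2
    linarith
  have f4 : (t / ρ - t / r + 1) * lawCgf m 1 ≤ K * lawCgf m 1 :=
    mul_le_mul_of_nonpos_right (by linarith [Nat.cast_nonneg (α := ℝ) j]) hΛ1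
  have f5 : κ * t * |Real.log c| + (s - 1) * (κ * t * Real.log 2) ≤ η / 2 * t := by
    have := mul_le_mul_of_nonneg_right hκη h0
    have hkt : 0 ≤ κ * t := by positivity
    rw [hD] at this
    linarith
  have e : t * (-s + lawCgf m s / r + lawCgf m 1 * (1 / ρ - 1 / r) - η) =
    -(s * t) + t / r * lawCgf m s + (t / ρ - t / r) * lawCgf m 1 - η * t := by ring
  rw [e]
  linarith

/-! ### Passage times, the conjugate, and failure of the asymptotics. -/

lemma lawMoment_map {Ω : Type*} [MeasurableSpace Ω] {P : Measure Ω} {A B : Ω → ℝ}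
    (hA : Measurable A) (hB : Measurable B) (s : ℝ) :
    lawMoment (P.map fun ω => (A ω, B ω)) s = Perpetuity.moment P A s :=
  lintegral_map (measurable_fst.ennreal_ofReal.pow_const s) (hA.prodMk hB)

/-- The probability that the passage time is `n` dominates the crossing probability at time
`n - 1`. -/
lemma toReal_crossingProb_le_measureReal {Ω : Type*} [MeasurableSpace Ω] {P : Measure Ω}
    [IsProbabilityMeasure P] {A B : ℕ → Ω → ℝ} {m : Measure (ℝ × ℝ)}
    (hZ : Measurable fun ω i => (A i ω, B i ω))
    (hlaw : P.map (fun ω i => (A i ω, B i ω)) = iidLaw m)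
    (hm : ∀ᵐ z ∂iidLaw m, ∀ i, 0 ≤ (z i).1 ∧ 0 < (z i).2) {n : ℕ} (hn : 1 ≤ n) (u : ℝ) :
    (crossingProb m (n - 1) u).toReal ≤ P.real {ω | passageTime A B u ω = (n : ℕ∞)} := by
  obtain ⟨k, rfl⟩ : ∃ k, n = k + 1 := ⟨n - 1, by omega⟩
  refine ENNReal.toReal_mono (measure_ne_top _ _) ?_
  have hmeas : MeasurableSet {z | seqPerpetuity k z ≤ u ∧ u < seqPerpetuity (k + 1) z} :=
    (measurableSet_crossing k).preimage (measurable_const.prodMk measurable_id)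
  rw [crossingProb, Nat.add_sub_cancel, ← hlaw, Measure.map_apply hZ hmeas]
  refine measure_mono_ae ?_
  rw [← hlaw] at hm
  filter_upwards [ae_of_ae_map hZ.aemeasurable hm] with ω hω hcross
  obtain ⟨h1, h2⟩ : perpetuity A B k ω ≤ u ∧ u < perpetuity A B (k + 1) ω := hcross
  refine le_antisymm (iInf₂_le (k + 1) ⟨by omega, h2⟩) (le_iInf₂ fun l hl => ?_)
  by_contra! hlt
  have hlk : l ≤ k := by
    have : l < k + 1 := by exact_mod_cast hlt
    omega
  have hmono : perpetuity A B l ω ≤ perpetuity A B k ω :=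
    monotone_seqPerpetuity (z := fun i => (A i ω, B i ω)) hω hlk
  linarith [hl.2]

/-- The tangent at `α` has slope `ρ`, so the supremum defining `Λ*(ρ)` is attained at `α`. Infinite
moments contribute `⊥`. -/
lemma sub_log_lawMoment_le {m : Measure (ℝ × ℝ)} {α ρ : ℝ} (hm : posLaw m ≠ 0)
    (hα : α ∈ interior (integrableExpSet logFst (posLaw m))) (hder : deriv (lawCgf m) α = ρ)
    (s : ℝ) :
    ((s * ρ : ℝ) : EReal) - ENNReal.log (lawMoment m s) ≤ ((α * ρ - lawCgf m α : ℝ) : EReal) := by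
  by_cases htop : lawMoment m s = ∞
  · simp [htop]
  have hs := mem_integrableExpSet_of_lawMoment htop
  have h1 := cgf_add_deriv_mul_le hα hs hm
  change lawCgf m α + deriv (lawCgf m) α * (s - α) ≤ lawCgf m s at h1
  rw [hder] at h1
  have h2 : 0 < mgf logFst (posLaw m) s := mgf_pos' hm hs
  have h3 := mgf_logFst_le_lawMoment htop
  rw [ENNReal.log_pos_real' (h2.trans_le h3), ← EReal.coe_sub, EReal.coe_le_coe_iff]
  have h4 : lawCgf m s ≤ Real.log (lawMoment m s).toReal := Real.log_le_log h2 h3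
  linarith

/-- The oscillating factor is bounded by `1 + l⁻¹` because the fractional part lies in `[0, 1)`, so
the extra `u ^ δ` contradicts even a big-O bound. -/
lemma not_isEquivalent_of_le {p : ℝ → ℝ} {l ρ a δ C : ℝ} (hl : 0 < l) (hδ : 0 < δ) (hC : 0 < C)
    (h : ∀ᶠ u : ℝ in atTop, C / √(Real.log u) * u ^ (-a) * u ^ δ ≤ p u) (c : ℝ) :
    ¬ Asymptotics.IsEquivalent atTop p (fun u : ℝ => c * l ^ (-Int.fract (Real.log u / ρ)) /
        √(Real.log u) * u ^ (-a)) := by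
  intro heq
  obtain ⟨K, hK⟩ := heq.isBigO.bound
  have hlim : Tendsto (fun u : ℝ => C * u ^ δ) atTop atTop :=
    (tendsto_rpow_atTop hδ).const_mul_atTop hC
  obtain ⟨u, hu, hKu, hpu, hu1⟩ := ((hlim.eventually_gt_atTop (|K| * (|c| * (1 + l⁻¹)))).and
    (hK.and (h.and (eventually_gt_atTop 1)))).exists
  have hu0 : 0 < u := by linarith
  have hlog : 0 < √(Real.log u) := Real.sqrt_pos.2 (Real.log_pos hu1)
  have hua : 0 < u ^ (-a) := Real.rpow_pos_of_pos hu0 _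
  have hpow : l ^ (-Int.fract (Real.log u / ρ)) ≤ 1 + l⁻¹ := by
    have f0 := Int.fract_nonneg (Real.log u / ρ)
    have f1 := (Int.fract_lt_one (Real.log u / ρ)).le
    have hinv : 0 < l⁻¹ := inv_pos.2 hl
    rcases le_total l 1 with hl1 | hl1
    · have := Real.rpow_le_rpow_of_exponent_ge hl hl1 (neg_le_neg f1)
      rw [Real.rpow_neg_one] at this
      linarith
    · have := Real.rpow_le_rpow_of_exponent_le hl1 (neg_nonpos.2 f0)
      rw [Real.rpow_zero] at this
      linarith
  have hle : ‖c * l ^ (-Int.fract (Real.log u / ρ)) / √(Real.log u) * u ^ (-a)‖ ≤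
      |c| * (1 + l⁻¹) * (u ^ (-a) / √(Real.log u)) := by
    rw [Real.norm_eq_abs, abs_mul, abs_div, abs_mul, abs_of_pos hlog, abs_of_pos hua,
      abs_of_pos (Real.rpow_pos_of_pos hl _), div_mul_eq_mul_div, mul_div_assoc]
    gcongr
  have h1 : C * u ^ δ * (u ^ (-a) / √(Real.log u)) ≤
      |K| * (|c| * (1 + l⁻¹)) * (u ^ (-a) / √(Real.log u)) := by
    calc C * u ^ δ * (u ^ (-a) / √(Real.log u)) = C / √(Real.log u) * u ^ (-a) * u ^ δ := by ring
      _ ≤ p u := hpu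
      _ ≤ ‖p u‖ := Real.le_norm_self _
      _ ≤ K * _ := hKu
      _ ≤ |K| * (|c| * (1 + l⁻¹) * (u ^ (-a) / √(Real.log u))) := by
        gcongr
        exact le_abs_self K
      _ = _ := by ring
  exact absurd (le_of_mul_le_mul_right h1 (by positivity)) (not_le.2 hu)

end

end Perpetuity

theorem theorem2 {Ω : Type*} [MeasurableSpace Ω] (P : Measure Ω) [IsProbabilityMeasure P]
    (A B : ℕ → Ω → ℝ)
    -- the pairs `(A n, B n)` are i.i.d. with values in `[0, ∞) × ℝ`
    (hA_meas : ∀ n, Measurable (A n)) (hB_meas : ∀ n, Measurable (B n))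
    (h_indep : iIndepFun (fun n ω => (A n ω, B n ω)) P)
    (h_ident : ∀ n, IdentDistrib (fun ω => (A n ω, B n ω)) (fun ω => (A 0 ω, B 0 ω)) P P)
    (hA_nonneg : ∀ᵐ ω ∂P, 0 ≤ A 0 ω)
    -- `ρ = Λ'(α) > 0`
    (ρ α : ℝ) (hρ : 0 < ρ) (hα : 1 < α)
    (h_deriv : HasDerivAt (fun s => (Perpetuity.logMoment P (A 0) s).toReal) ρ α)
    -- negative drift and moments
    (h_drift : Perpetuity.NegativeDrift P (A 0))
    (ε : ℝ) (hε : 0 < ε)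
    (hA_mom : ∫⁻ ω, ENNReal.ofReal (A 0 ω ^ (α + ε)) ∂P < ∞)
    (hB_mom : ∫⁻ ω, ENNReal.ofReal (|B 0 ω| ^ (α + ε)) ∂P < ∞)
    -- `Λ(α) < Λ(1)`
    (h_lt : Perpetuity.logMoment P (A 0) α < Perpetuity.logMoment P (A 0) 1)
    (hB_pos : ∀ᵐ ω ∂P, 0 < B 0 ω)
    -- lower bound for the joint law: `1_{(b₁, b₂)}(b) μ(da, db) ≥ g(a) da ν(db)`
    (b₁ b₂ : ℝ) (hb₁ : 0 < b₁) (hb : b₁ < b₂)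
    (ν : Measure ℝ) [IsFiniteMeasure ν] (hν : ν ≠ 0)
    (g : ℝ → ℝ) (hg_cont : ContinuousOn g (Ioi 0)) (hg_pos : ∀ a, 0 < a → 0 < g a)
    (h_lower :
      ((volume.restrict (Ioi (0 : ℝ))).withDensity (fun a => ENNReal.ofReal (g a))).prod ν ≤
        (P.map (fun ω => (A 0 ω, B 0 ω))).restrict (univ ×ˢ Ioo b₁ b₂)) :
    (∃ δ : ℝ, 0 < δ ∧ ∃ C : ℝ, 0 < C ∧ ∀ᶠ u : ℝ in atTop,
      C / √(Real.log u) * u ^ (-Perpetuity.alphaBar P (A 0) ρ) * u ^ δ ≤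
        Perpetuity.passageProb P A B ρ u) ∧
    -- in particular the asymptotics `c λ(α)^{-Θ(u)} u^{-ᾱ} / √(log u)` fails for every `c`
    (∀ c : ℝ, ¬ Asymptotics.IsEquivalent atTop
      (fun u : ℝ => Perpetuity.passageProb P A B ρ u)
      (fun u : ℝ => c * (Perpetuity.moment P (A 0) α).toReal ^ (-Int.fract (Real.log u / ρ)) /
        √(Real.log u) * u ^ (-Perpetuity.alphaBar P (A 0) ρ))) := by
  open Perpetuity in
  set m : Measure (ℝ × ℝ) := P.map (fun ω => (A 0 ω, B 0 ω)) with hm_def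
  have hpair : Measurable fun ω => (A 0 ω, B 0 ω) := (hA_meas 0).prodMk (hB_meas 0)
  have : IsProbabilityMeasure m := Measure.isProbabilityMeasure_map hpair.aemeasurable
  have hdens : HasDensityComponent m b₁ b₂ ν g := ⟨hb₁, hν, hg_cont, hg_pos, h_lower⟩
  have hZ : Measurable fun ω i => (A i ω, B i ω) :=
    measurable_pi_iff.2 fun i => (hA_meas i).prodMk (hB_meas i)
  have hlaw : P.map (fun ω i => (A i ω, B i ω)) = iidLaw m := by
    rw [h_indep.map_fun_eq_infinitePi_map fun i => (hA_meas i).prodMk (hB_meas i)]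
    congr 1
    funext i
    exact (h_ident i).map_eq
  have hmpos : ∀ᵐ z ∂iidLaw m, ∀ i, 0 ≤ (z i).1 ∧ 0 < (z i).2 := by
    have h1 : ∀ᵐ p ∂m, 0 ≤ p.1 ∧ 0 < p.2 := by
      have hset : MeasurableSet {p : ℝ × ℝ | 0 ≤ p.1 ∧ 0 < p.2} :=
        (measurableSet_le measurable_const measurable_fst).inter
          (measurableSet_lt measurable_const measurable_snd)
      rw [hm_def, ae_map_iff hpair.aemeasurable hset]
      filter_upwards [hA_nonneg, hB_pos] with ω h h' using ⟨h, h'⟩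
    rw [ae_all_iff]
    intro i
    have hmp := measurePreserving_eval_infinitePi (fun _ : ℕ => m) i
    rw [← hmp.map_eq] at h1
    exact ae_of_ae_map hmp.measurable.aemeasurable h1
  set S := α + ε with hS
  have hmoment : ∀ s, lawMoment m s = Perpetuity.moment P (A 0) s := lawMoment_map (hA_meas 0) (hB_meas 0)
  have hA : lawMoment m S ≠ ∞ := by
    rw [hmoment, Perpetuity.moment]
    refine ne_of_lt (lt_of_eq_of_lt (lintegral_congr_ae ?_) hA_mom)
    filter_upwards [hA_nonneg] with ω hω
    exact ENNReal.ofReal_rpow_of_nonneg hω (by linarith)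
  have hB : ∫⁻ p, ENNReal.ofReal p.2 ^ S ∂m ≠ ∞ := by
    rw [hm_def, lintegral_map (measurable_snd.ennreal_ofReal.pow_const S) hpair]
    refine ne_of_lt (lt_of_eq_of_lt (lintegral_congr_ae ?_) hB_mom)
    filter_upwards [hB_pos] with ω hω
    rw [abs_of_pos hω]
    exact ENNReal.ofReal_rpow_of_nonneg hω.le (by linarith)
  have hαS : α < S := by linarith
  have hlog : ∀ s, 0 < s → s ≤ S → logMoment P (A 0) s = (lawCgf m s : EReal) := by
    intro s hs hsS
    rw [logMoment, ← hmoment, hdens.lawMoment_eq hA hs hsS,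
      ENNReal.log_ofReal_of_pos (Real.exp_pos _), Real.log_exp]
  have hder : deriv (lawCgf m) α = ρ := by
    refine (h_deriv.congr_of_eventuallyEq ?_).deriv
    filter_upwards [Ioo_mem_nhds (show 0 < α by linarith) hαS] with s hs
    rw [hlog s hs.1 hs.2.le, EReal.toReal_coe]
  have hlt : lawCgf m α < lawCgf m 1 := by
    rw [hlog α (by linarith) hαS.le, hlog 1 one_pos (by linarith)] at h_lt
    exact_mod_cast h_lt
  have hbar : alphaBar P (A 0) ρ = α - lawCgf m α / ρ := by
    have hconj : conjugate P (A 0) ρ = ((α * ρ - lawCgf m α : ℝ) : EReal) := by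
      refine le_antisymm (iSup_le fun s => ?_) (le_iSup_of_le α ?_)
      · rw [logMoment, ← hmoment]
        exact sub_log_lawMoment_le hdens.posLaw_ne_zero
          (mem_interior_integrableExpSet hA (by linarith) hαS) hder s
      · rw [hlog α (by linarith) hαS.le, ← EReal.coe_sub]
    rw [alphaBar, hconj, EReal.toReal_coe]
    field_simp
  obtain ⟨s, r, hαs, hsS, hρr, hders, hgain⟩ :=
    exists_better_slope hdens hA hρ hα hαS hder hlt
  set D := -s + lawCgf m s / r + lawCgf m 1 * (1 / ρ - 1 / r) with hD
  -- Half of the gain in the exponent pays for the subexponential errors (`η = δ` in `hcross`); the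
  -- other half is the `δ` of the conclusion.
  set δ := (D - (-α + lawCgf m α / ρ)) / 2 with hδ
  have hδ0 : 0 < δ := by rw [hδ]; linarith
  have hcross := eventually_le_crossingProb hdens hmpos hA hB hα hαs hsS hlt hρ hρr hders hδ0
  have hmain : ∀ᶠ u : ℝ in atTop,
      1 / √(Real.log u) * u ^ (-alphaBar P (A 0) ρ) * u ^ δ ≤ passageProb P A B ρ u := by
    filter_upwards [Real.tendsto_log_atTop.eventually hcross,
      Real.tendsto_log_atTop.eventually_ge_atTop 1,
      Real.tendsto_log_atTop.eventually_ge_atTop ρ, eventually_gt_atTop 0] with u h1 h2 h3 hu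
    rw [Real.exp_log hu] at h1
    have hn : 1 ≤ ⌊Real.log u / ρ⌋₊ := by
      rw [Nat.one_le_floor_iff, one_le_div hρ]
      exact h3
    refine le_trans ?_ (toReal_crossingProb_le_measureReal hZ hlaw hmpos hn u)
    have hfin : crossingProb m (⌊Real.log u / ρ⌋₊ - 1) u ≠ ∞ := measure_ne_top _ _
    refine le_trans ?_ ((ENNReal.ofReal_le_iff_le_toReal hfin).1 h1)
    have hsq : 1 / √(Real.log u) ≤ 1 := by
      rw [div_le_one (Real.sqrt_pos.2 (by linarith))]
      exact Real.one_le_sqrt.2 h2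
    calc 1 / √(Real.log u) * u ^ (-alphaBar P (A 0) ρ) * u ^ δ
        ≤ 1 * u ^ (-alphaBar P (A 0) ρ) * u ^ δ := by gcongr
      _ = Real.exp (Real.log u * (D - δ)) := by
        rw [one_mul, ← Real.rpow_add hu, Real.rpow_def_of_pos hu, hbar]
        congr 2
        rw [hδ]; ring
  refine ⟨⟨δ, hδ0, 1, one_pos, hmain⟩, fun c => ?_⟩
  refine not_isEquivalent_of_le ?_ hδ0 one_pos hmain c
  rw [← hmoment, hdens.lawMoment_eq hA (by linarith) hαS.le]
  exact ENNReal.toReal_pos (by simp [Real.exp_pos]) ENNReal.ofReal_ne_top
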